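/- Let $d \ge 1$, let $H=(H_1,\dots,H_d)\in(0,1)^d$ and $\bar H=(H_1+\cdots+H_d)/d$. Let $W^H=(W^H_t)_{t\in[0,1]^d}$ be a fractional Brownian sheet of Hurst multiparameter $H$ on a probability space, i.e. a centered Gaussian process with $$\mathbb E(W^H_tW^H_{t'})=\prod_{i=1}^d\frac{|t_i|^{2H_i}+|t'_i|^{2H_i}-|t_i-t'_i|^{2H_i}}{2},\qquad t,t'\in[0,1]^d,$$ with almost surely continuous sample paths. Definitions. For $u \in L^1(\mathbb R^d)$, $\|Du\|(\mathbb R^d)$ is the supremum of $\int u\,\mathrm{div}\,v$ over all $v\in C^1_c(\mathbb R^d;\mathbb R^d)$ with $|v|\le 1$. $BV([0,1]^d)$ is the space of all $u\in L^1(\mathbb R^d)$ that vanish a.e. outside $[0,1]^d$ and have $\|Du\|(\mathbb R^d)<\infty$, with the norm $\|u\|_1+\|Du\|(\mathbb R^d)$. A $BV$-subset of $[0,1]^d$ is a measurable set $B\subset[0,1]^d$ with $\mathbf 1_B\in BV([0,1]^d)$; its perimeter is $\|B\|=\|D\mathbf 1_B\|(\mathbb R^d)$. A charge is a real function $\mu$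 of the $BV$-subsets of $[0,1]^d$ such that $\mu(B_1\cup B_2)=\mu(B_1)+\mu(B_2)$ whenever $|B_1\cap B_2|=0$, and $\mu(B_n)\to\mu(B)$ whenever $\sup_n\|B_n\|<\infty$ and $|B_n\triangle B|\to0$. A strong charge is a charge of the form $\mu(B)=\alpha(\mathbf 1_B)$, where $\alpha$ belongs to the closure in $BV([0,1]^d)^*$ (for the operator norm) of the set of functionals $u\mapsto\int_{[0,1]^d}fu$ with $f\in L^d([0,1]^d)$. Let $f$ be in $C_0([0,1]^d)$, i.e. continuous on $[0,1]^d$ with $f(x)=0$ whenever some $x_i=0$. Its increment on a nondegenerate rectangle is $$\Delta_f\Big(\prod_{i=1}^d[a_i,b_i]\Big)=\sum_{c\in\prod_i\{a_i,b_i\}}(-1)^{\#\{i:\,c_i=a_i\}}f(c),$$ and $\Delta_f$ is extended additively to figures, i.e. finite unions of pairwise almost disjoint rectangles in $[0,1]^d$. The function $f$ is strongly chargeable if $\Delta_f$ extends to a strong charge. A strong charge $\mu$ is $\gamma$-Hölder if there is $C\ge0$ with $|\mu(K)|\le C|K|^\gamma$ for all dyadic cubes $K=\prod_i[2^{-n}k_i,2^{-n}(k_i+1)]\subset[0,1]^d$.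 Theorem. If $\bar H>\frac{d-1}{d}$, then almost surely the sample path $t\mapsto W^H_t$ belongs to $C_0([0,1]^d)$ and is strongly chargeable: its increment function extends to a strong charge which is $\gamma$-Hölder for every $0<\gamma<\bar H$. -/

import Mathlib

open MeasureTheory ProbabilityTheory
open scoped ENNReal Topology

noncomputable section

namespace FBS

/-- The unit cube `[0,1]^d`. -/
abbrev cube (d : ℕ) : Set (Fin d → ℝ) := Set.Icc 0 1

/-! ### Functions of bounded variation -/

/-- The divergence of a vector field on `ℝ^d`. -/
def divergence {d : ℕ} (v : (Fin d → ℝ) → EuclideanSpace ℝ (Fin d)) (x : Fin d → ℝ) : ℝ :=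
  ∑ i, fderiv ℝ v x (Pi.single i 1) i

/-- Compactly supported `C¹` vector fields on `ℝ^d` whose Euclidean norm is at most `1`. -/
structure IsTestField {d : ℕ} (v : (Fin d → ℝ) → EuclideanSpace ℝ (Fin d)) : Prop where
  contDiff : ContDiff ℝ 1 v
  hasCompactSupport : HasCompactSupport v
  norm_le_one : ∀ x, ‖v x‖ ≤ 1

/-- The variation `‖Du‖(ℝ^d)` of an integrable function `u`. -/
def variation {d : ℕ} (u : (Fin d → ℝ) → ℝ) : ℝ≥0∞ :=
  ⨆ (v : (Fin d → ℝ) → EuclideanSpace ℝ (Fin d)) (_ : IsTestField v),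
    ENNReal.ofReal (∫ x, u x * divergence v x)

theorem IsTestField.continuous_divergence {d : ℕ} {v : (Fin d → ℝ) → EuclideanSpace ℝ (Fin d)}
    (hv : IsTestField v) : Continuous (divergence v) := by
  unfold divergence
  refine continuous_finsetSum _ fun i _ => ?_
  have h := hv.contDiff.continuous_fderiv (by norm_num)
  have h2 : Continuous fun x => fderiv ℝ v x (Pi.single i 1) := h.clm_apply continuous_const
  exact (EuclideanSpace.proj (𝕜 := ℝ) i).continuous.comp h2

theorem IsTestField.integrable_mul {d : ℕ} {v : (Fin d → ℝ) → EuclideanSpace ℝ (Fin d)}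
    (hv : IsTestField v) {u : (Fin d → ℝ) → ℝ} (hu : Integrable u) :
    Integrable (fun x => u x * divergence v x) := by
  have hc : HasCompactSupport (divergence v) := by
    refine (hv.hasCompactSupport.fderiv (𝕜 := ℝ)).mono fun x hx => ?_
    contrapose! hx
    simp only [Function.mem_support, not_not] at hx ⊢
    simp [divergence, hx]
  obtain ⟨C, hC⟩ := hc.exists_bound_of_continuous hv.continuous_divergence
  exact hu.mul_bdd hv.continuous_divergence.aestronglyMeasurable (ae_of_all _ hC)

theorem variation_congr {d : ℕ} {u w : (Fin d → ℝ) → ℝ} (h : u =ᵐ[volume] w) :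
    variation u = variation w := by
  unfold variation
  refine iSup_congr fun v => iSup_congr fun _ => ?_
  congr 1
  exact integral_congr_ae (h.mono fun x hx => by simp [hx])

theorem variation_zero {d : ℕ} : variation (0 : (Fin d → ℝ) → ℝ) = 0 := by
  simp [variation]

theorem variation_add_le {d : ℕ} {u w : (Fin d → ℝ) → ℝ} (hu : Integrable u)
    (hw : Integrable w) : variation (u + w) ≤ variation u + variation w := by
  refine iSup₂_le fun v hv => ?_
  have : ∫ x, (u + w) x * divergence v x
      = (∫ x, u x * divergence v x) + ∫ x, w x * divergence v x := by
    rw [← integral_add (hv.integrable_mul hu) (hv.integrable_mul hw)]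
    simp [add_mul]
  rw [this]
  refine ENNReal.ofReal_add_le.trans (add_le_add ?_ ?_)
  · exact le_iSup₂ (f := fun v (_ : IsTestField v) =>
      ENNReal.ofReal (∫ x, u x * divergence v x)) v hv
  · exact le_iSup₂ (f := fun v (_ : IsTestField v) =>
      ENNReal.ofReal (∫ x, w x * divergence v x)) v hv

theorem IsTestField.neg {d : ℕ} {v : (Fin d → ℝ) → EuclideanSpace ℝ (Fin d)}
    (hv : IsTestField v) : IsTestField (-v) :=
  ⟨hv.contDiff.neg, hv.hasCompactSupport.neg, fun x => by simpa using hv.norm_le_one x⟩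

theorem divergence_neg {d : ℕ} (v : (Fin d → ℝ) → EuclideanSpace ℝ (Fin d)) (x : Fin d → ℝ) :
    divergence (-v) x = -divergence v x := by
  simp [divergence, fderiv_neg]

theorem variation_smul_le {d : ℕ} (c : ℝ) (u : (Fin d → ℝ) → ℝ) :
    variation (c • u) ≤ ENNReal.ofReal |c| * variation u := by
  refine iSup₂_le fun v hv => ?_
  have key : ∀ w : (Fin d → ℝ) → EuclideanSpace ℝ (Fin d), IsTestField w →
      ENNReal.ofReal (|c| * ∫ x, u x * divergence w x) ≤ ENNReal.ofReal |c| * variation u := by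
    intro w hw
    rw [ENNReal.ofReal_mul (abs_nonneg c)]
    gcongr
    exact le_iSup₂ (f := fun v (_ : IsTestField v) =>
      ENNReal.ofReal (∫ x, u x * divergence v x)) w hw
  have h1 : ∫ x, (c • u) x * divergence v x = c * ∫ x, u x * divergence v x := by
    rw [← integral_const_mul]
    simp [mul_assoc]
  rw [h1]
  rcases le_total 0 c with hc | hc
  · simpa [abs_of_nonneg hc] using key v hv
  · have := key (-v) hv.neg
    simpa [abs_of_nonpos hc, divergence_neg, integral_neg] using this

/-- The functions in `BV(ℝ^d)` that vanish almost everywhere outside `[0,1]^d`, as a subspace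
of `L¹(ℝ^d)`. -/
def bvSubmodule (d : ℕ) : Submodule ℝ (Lp ℝ 1 (volume : Measure (Fin d → ℝ))) where
  carrier := {u | variation u < ∞ ∧ ∀ᵐ x, x ∉ cube d → u x = 0}
  zero_mem' := by
    refine ⟨?_, ?_⟩
    · rw [variation_congr (Lp.coeFn_zero ℝ 1 volume), variation_zero]
      exact ENNReal.zero_lt_top
    · filter_upwards [Lp.coeFn_zero ℝ 1 (volume : Measure (Fin d → ℝ))] with x hx _
      rw [hx, Pi.zero_apply]
  add_mem' := by
    rintro u w ⟨hu, hu'⟩ ⟨hw, hw'⟩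
    refine ⟨?_, ?_⟩
    · rw [variation_congr (Lp.coeFn_add u w)]
      exact (variation_add_le (L1.integrable_coeFn u) (L1.integrable_coeFn w)).trans_lt
        (ENNReal.add_lt_top.2 ⟨hu, hw⟩)
    · filter_upwards [Lp.coeFn_add u w, hu', hw'] with x hx h1 h2 hxc
      rw [hx, Pi.add_apply, h1 hxc, h2 hxc, add_zero]
  smul_mem' := by
    rintro c u ⟨hu, hu'⟩
    refine ⟨?_, ?_⟩
    · rw [variation_congr (Lp.coeFn_smul c u)]
      exact (variation_smul_le c u).trans_lt (ENNReal.mul_lt_top ENNReal.ofReal_lt_top hu)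
    · filter_upwards [Lp.coeFn_smul c u, hu'] with x hx h1 hxc
      rw [hx, Pi.smul_apply, h1 hxc, smul_zero]

/-- The space `BV([0,1]^d)`; a type synonym, so that it carries the norm `‖u‖₁ + ‖Du‖(ℝ^d)`
instead of the norm of `L¹`. -/
def BVCube (d : ℕ) : Type := bvSubmodule d

namespace BVCube

variable {d : ℕ}

instance : AddCommGroup (BVCube d) := inferInstanceAs (AddCommGroup (bvSubmodule d))

instance : Module ℝ (BVCube d) := inferInstanceAs (Module ℝ (bvSubmodule d))

/-- The inclusion of `BV([0,1]^d)` into `L¹(ℝ^d)`. -/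
def toL1 : BVCube d →ₗ[ℝ] Lp ℝ 1 (volume : Measure (Fin d → ℝ)) := (bvSubmodule d).subtype

instance : CoeFun (BVCube d) (fun _ => (Fin d → ℝ) → ℝ) := ⟨fun u => (toL1 u : (Fin d → ℝ) → ℝ)⟩

theorem variation_lt_top (u : BVCube d) : variation u < ∞ := u.2.1

/-- The norm `‖u‖_BV = ‖u‖₁ + ‖Du‖(ℝ^d)`. -/
instance : Norm (BVCube d) := ⟨fun u => (∫ x, |u x|) + (variation u).toReal⟩

theorem norm_def (u : BVCube d) : ‖u‖ = (∫ x, |u x|) + (variation u).toReal := rfl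

theorem norm_eq (u : BVCube d) : ‖u‖ = ‖toL1 u‖ + (variation u).toReal := by
  rw [norm_def, L1.norm_eq_integral_norm]
  rfl

theorem normedSpaceCore : NormedSpace.Core ℝ (BVCube d) where
  norm_nonneg u := by
    rw [norm_eq]
    positivity
  norm_smul c u := by
    have h1 : ∀ (c : ℝ) (u : BVCube d),
        (variation (c • u : BVCube d)).toReal ≤ |c| * (variation u).toReal := by
      intro c u
      have : variation (c • u : BVCube d) ≤ ENNReal.ofReal |c| * variation u := by
        rw [map_smul, variation_congr (Lp.coeFn_smul c (toL1 u))]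
        exact variation_smul_le c _
      have h := ENNReal.toReal_mono
        (ENNReal.mul_lt_top ENNReal.ofReal_lt_top u.variation_lt_top).ne this
      simpa [ENNReal.toReal_mul] using h
    have h2 : (variation (c • u : BVCube d)).toReal = |c| * (variation u).toReal := by
      refine le_antisymm (h1 c u) ?_
      rcases eq_or_ne c 0 with rfl | hc
      · simp
      · have := h1 c⁻¹ (c • u)
        rw [inv_smul_smul₀ hc, abs_inv] at this
        have hc' : 0 < |c| := abs_pos.2 hc
        rwa [le_inv_mul_iff₀ hc'] at this
    rw [norm_eq, norm_eq, h2, map_smul, norm_smul, Real.norm_eq_abs]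
    ring
  norm_triangle u w := by
    have h : variation (u + w : BVCube d) ≤ variation u + variation w := by
      rw [map_add, variation_congr (Lp.coeFn_add (toL1 u) (toL1 w))]
      exact variation_add_le (L1.integrable_coeFn _) (L1.integrable_coeFn _)
    have h' := ENNReal.toReal_mono
      (ENNReal.add_lt_top.2 ⟨u.variation_lt_top, w.variation_lt_top⟩).ne h
    rw [ENNReal.toReal_add u.variation_lt_top.ne w.variation_lt_top.ne] at h'
    have := norm_add_le (toL1 u) (toL1 w)
    rw [norm_eq, norm_eq, norm_eq, map_add] at *
    linarith
  norm_eq_zero_iff u := by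
    constructor
    · intro h
      rw [norm_eq] at h
      have h0 : ‖toL1 u‖ = 0 :=
        le_antisymm (by linarith [(ENNReal.toReal_nonneg : 0 ≤ (variation u).toReal)])
          (norm_nonneg _)
      exact Subtype.ext (norm_eq_zero.1 h0)
    · rintro rfl
      rw [norm_eq, map_zero, variation_congr (Lp.coeFn_zero ℝ 1 volume), variation_zero]
      simp

instance : NormedAddCommGroup (BVCube d) := NormedAddCommGroup.ofCore normedSpaceCore

instance : NormedSpace ℝ (BVCube d) := NormedSpace.ofCore normedSpaceCore

end BVCube

/-! ### `BV`-sets -/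

/-- The perimeter `‖A‖ = ‖D 1_A‖(ℝ^d)`. -/
def perimeter {d : ℕ} (A : Set (Fin d → ℝ)) : ℝ≥0∞ :=
  variation (A.indicator fun _ => (1 : ℝ))

/-- The `BV`-subsets of `[0,1]^d`: Lebesgue measurable subsets of finite perimeter. -/
structure BVSet (d : ℕ) where
  carrier : Set (Fin d → ℝ)
  subset_cube : carrier ⊆ cube d
  nullMeasurable : NullMeasurableSet carrier
  perimeter_lt_top : perimeter carrier < ∞

namespace BVSet

variable {d : ℕ}

theorem integrable_indicator (B : BVSet d) :
    Integrable (B.carrier.indicator fun _ => (1 : ℝ)) := by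
  refine IntegrableOn.integrable_indicator₀ (integrableOn_const ?_) B.nullMeasurable
  exact ((measure_mono B.subset_cube).trans_lt isCompact_Icc.measure_lt_top).ne

/-- The indicator function of a `BV`-subset of `[0,1]^d`, as an element of `BV([0,1]^d)`. -/
def ind (B : BVSet d) : BVCube d :=
  ⟨B.integrable_indicator.toL1 _, by
    have h := B.integrable_indicator.coeFn_toL1
    refine ⟨?_, ?_⟩
    · rw [variation_congr h]
      exact B.perimeter_lt_top
    · filter_upwards [h] with x hx hxc
      rw [hx]
      exact Set.indicator_of_notMem (fun hB => hxc (B.subset_cube hB)) _⟩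

end BVSet

section Rectangles

open Set

/-- Rectangles have finite perimeter. -/
theorem perimeter_Icc_lt_top {d : ℕ} (a b : Fin d → ℝ) (hab : a ≤ b) :
    perimeter (Icc a b) < ∞ := by
  cases d with
  | zero => simp [perimeter, variation, divergence]
  | succ n =>
    refine lt_of_le_of_lt (b := ENNReal.ofReal (∑ i : Fin (n+1),
      2 * (volume (Icc (a ∘ i.succAbove) (b ∘ i.succAbove))).toReal)) ?_ ENNReal.ofReal_lt_top
    refine iSup₂_le fun v hv => ENNReal.ofReal_le_ofReal ?_
    have h1 : ∫ x, (Icc a b).indicator (fun _ => (1:ℝ)) x * divergence v x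
        = ∫ x in Icc a b, ∑ i,
          ((EuclideanSpace.proj (𝕜 := ℝ) i).comp (fderiv ℝ v x)) (Pi.single i 1) := by
      rw [← integral_indicator measurableSet_Icc]
      congr 1; ext x
      by_cases hx : x ∈ Icc a b <;> simp [hx, divergence]
    have hd : ∀ x, HasFDerivAt v (fderiv ℝ v x) x := fun x =>
      ((hv.contDiff.differentiable (by norm_num)) x).hasFDerivAt
    rw [h1, integral_divergence_of_hasFDerivAt_off_countable' a b hab (fun i x => v x i)
      (fun i x => (EuclideanSpace.proj (𝕜 := ℝ) i).comp (fderiv ℝ v x)) ∅ countable_empty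
      (fun i => ((EuclideanSpace.proj (𝕜 := ℝ) i).continuous.comp hv.contDiff.continuous).continuousOn)
      (fun x _ i => (EuclideanSpace.proj (𝕜 := ℝ) i).hasFDerivAt.comp x (hd x))
      (by
        have : (fun x => ∑ i, ((EuclideanSpace.proj (𝕜 := ℝ) i).comp (fderiv ℝ v x)) (Pi.single i 1)) = divergence v := by
          ext x; simp [divergence]
        rw [this]; exact hv.continuous_divergence.continuousOn.integrableOn_compact isCompact_Icc)]
    refine Finset.sum_le_sum fun i _ => ?_
    have hb : ∀ y, ‖v y i‖ ≤ 1 := fun y => (PiLp.norm_apply_le (v y) i).trans (hv.norm_le_one y)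
    have hf : ∀ g : (Fin n → ℝ) → Fin (n+1) → ℝ,
        |∫ x in Icc (a ∘ i.succAbove) (b ∘ i.succAbove), v (g x) i| ≤
          (volume (Icc (a ∘ i.succAbove) (b ∘ i.succAbove))).toReal := fun g => by
      have := norm_setIntegral_le_of_norm_le_const (μ := volume)
        (s := Icc (a ∘ i.succAbove) (b ∘ i.succAbove)) (f := fun x => v (g x) i) (C := 1)
        isCompact_Icc.measure_lt_top (fun x _ => hb _)
      simpa [Measure.real] using this
    have e1 := abs_le.1 (hf (i.insertNth (α := fun _ => ℝ) (b i)))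
    have e2 := abs_le.1 (hf (i.insertNth (α := fun _ => ℝ) (a i)))
    linarith [e1.2, e2.1]

/-- Finite unions of pairwise almost disjoint rectangles in `[0,1]^d` are `BV`-sets. -/
theorem exists_bvSet_iUnion_Icc {d m : ℕ} (a b : Fin m → cube d)
    (hab : ∀ j, a j ≤ b j)
    (hdisj : ∀ j k, j ≠ k → volume (Set.Icc (a j : Fin d → ℝ) (b j) ∩ Set.Icc (a k) (b k)) = 0) :
    ∃ F : BVSet d, F.carrier = ⋃ j, Set.Icc (a j : Fin d → ℝ) (b j) := by
  have hint : ∀ j, Integrable ((Icc (a j : Fin d → ℝ) (b j)).indicator fun _ => (1 : ℝ)) := fun j =>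
    IntegrableOn.integrable_indicator (integrableOn_const isCompact_Icc.measure_lt_top.ne)
      measurableSet_Icc
  have hsum : ∀ s : Finset (Fin m), Integrable
      (∑ j ∈ s, (Icc (a j : Fin d → ℝ) (b j)).indicator fun _ => (1 : ℝ)) ∧
      variation (∑ j ∈ s, (Icc (a j : Fin d → ℝ) (b j)).indicator fun _ => (1 : ℝ)) < ∞ := by
    intro s
    induction s using Finset.cons_induction with
    | empty => simp [variation_zero]
    | cons j s hj ih =>
      rw [Finset.sum_cons]
      exact ⟨(hint j).add ih.1, (variation_add_le (hint j) ih.1).trans_lt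
        (ENNReal.add_lt_top.2 ⟨perimeter_Icc_lt_top _ _ (hab j), ih.2⟩)⟩
  refine ⟨⟨_, iUnion_subset fun j => Icc_subset_Icc (a j).2.1 (b j).2.2,
    (MeasurableSet.iUnion fun j => measurableSet_Icc).nullMeasurableSet, ?_⟩, rfl⟩
  rw [perimeter, variation_congr (w := ∑ j, (Icc (a j : Fin d → ℝ) (b j)).indicator fun _ => (1 : ℝ))]
  · exact (hsum _).2
  · have : ∀ᵐ x, ∀ j k, j ≠ k → x ∉ Set.Icc (a j : Fin d → ℝ) (b j) ∩ Set.Icc (a k) (b k) := by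
      simp only [ae_all_iff]
      exact fun j k h => measure_eq_zero_iff_ae_notMem.1 (hdisj j k h)
    filter_upwards [this] with x hx
    rw [Finset.sum_apply]
    by_cases hU : x ∈ ⋃ j, Icc (a j : Fin d → ℝ) (b j)
    · obtain ⟨j, hj⟩ := mem_iUnion.1 hU
      rw [indicator_of_mem hU, Finset.sum_eq_single j, indicator_of_mem hj]
      · exact fun k _ hk => indicator_of_notMem (fun h => hx k j hk ⟨h, hj⟩) _
      · simp
    · rw [indicator_of_notMem hU, Finset.sum_eq_zero]
      exact fun j _ => indicator_of_notMem (fun h => hU (mem_iUnion.2 ⟨j, h⟩)) _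

end Rectangles

/-! ### Charges and strong charges -/

/-- `μ` is a charge on `[0,1]^d`: it is finitely additive, and continuous with respect to
`BV`-convergence. -/
structure IsCharge {d : ℕ} (μ : BVSet d → ℝ) : Prop where
  additive : ∀ B₁ B₂ B : BVSet d, volume (B₁.carrier ∩ B₂.carrier) = 0 →
    B.carrier = B₁.carrier ∪ B₂.carrier → μ B = μ B₁ + μ B₂
  tendsto : ∀ (B : ℕ → BVSet d) (B' : BVSet d),
    (⨆ n, perimeter (B n).carrier) < ∞ →
    Filter.Tendsto (fun n => volume (symmDiff (B n).carrier B'.carrier)) Filter.atTop (𝓝 0) →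
    Filter.Tendsto (fun n => μ (B n)) Filter.atTop (𝓝 (μ B'))

/-- The space `SCH([0,1]^d)` of strong charge functionals: the closure, in the dual Banach space
of `BV([0,1]^d)`, of the functionals `T_f : u ↦ ∫_{[0,1]^d} f u` with `f ∈ L^d([0,1]^d)`. -/
def SCH (d : ℕ) : Set (StrongDual ℝ (BVCube d)) :=
  closure {α | ∃ f : (Fin d → ℝ) → ℝ, MemLp f d (volume.restrict (cube d)) ∧
    ∀ u : BVCube d, α u = ∫ x in cube d, f x * u x}

/-- `μ` is a strong charge: a charge of the form `B ↦ α(1_B)` with `α ∈ SCH([0,1]^d)`. -/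
structure IsStrongCharge {d : ℕ} (μ : BVSet d → ℝ) : Prop where
  isCharge : IsCharge μ
  exists_functional : ∃ α ∈ SCH d, ∀ B : BVSet d, μ B = α B.ind

/-- The vertex of the rectangle `∏ [a_i, b_i]` whose `i`-th coordinate is `a_i` for `i ∈ s` and
`b_i` for `i ∉ s`. -/
def vertex {d : ℕ} (a b : cube d) (s : Finset (Fin d)) : cube d :=
  ⟨s.piecewise a b, s.piecewise_mem_Icc_of_mem_of_mem a.2 b.2⟩

/-- The increment `Δ_f` on the rectangle `∏ [a_i, b_i]`: the sum of the values of `f` at the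
vertices, with the sign `(-1)` to the number of coordinates equal to `a_i`. -/
def increment {d : ℕ} (f : cube d → ℝ) (a b : cube d) : ℝ :=
  ∑ s : Finset (Fin d), (-1) ^ s.card * f (vertex a b s)

/-- `μ` extends the finitely additive function `Δ_f` on figures: if a figure `F` is written as a
finite union of pairwise almost disjoint nondegenerate rectangles, then `μ(F)` is the sum of the
increments of `f` on these rectangles. -/
def ExtendsIncrement {d : ℕ} (f : cube d → ℝ) (μ : BVSet d → ℝ) : Prop :=
  ∀ (m : ℕ) (a b : Fin m → cube d),
    (∀ j i, (a j : Fin d → ℝ) i < (b j : Fin d → ℝ) i) →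
    (∀ j k, j ≠ k → volume (Set.Icc (a j : Fin d → ℝ) (b j) ∩ Set.Icc (a k) (b k)) = 0) →
    ∀ F : BVSet d, F.carrier = ⋃ j, Set.Icc (a j : Fin d → ℝ) (b j) →
      μ F = ∑ j, increment f (a j) (b j)

/-- The space `C_0([0,1]^d)`: continuous functions that vanish where some coordinate is `0`. -/
def IsC0 {d : ℕ} (f : cube d → ℝ) : Prop :=
  Continuous f ∧ ∀ x : cube d, (∃ i, (x : Fin d → ℝ) i = 0) → f x = 0

/-- The dyadic cubes `∏ [2^{-n} k_i, 2^{-n} (k_i + 1)]` in `[0,1]^d`. -/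
def IsDyadicCube {d : ℕ} (K : Set (Fin d → ℝ)) : Prop :=
  ∃ (n : ℕ) (k : Fin d → ℕ), (∀ i, k i < 2 ^ n) ∧
    K = Set.Icc (fun i => (k i : ℝ) / 2 ^ n) (fun i => ((k i : ℝ) + 1) / 2 ^ n)

/-- The `γ`-Hölder property: `|μ(K)| ≤ C |K|^γ` for all dyadic cubes `K`. -/
def IsHolderOnDyadic {d : ℕ} (γ : ℝ) (μ : BVSet d → ℝ) : Prop :=
  ∃ C : ℝ, 0 ≤ C ∧ ∀ K : BVSet d, IsDyadicCube K.carrier →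
    |μ K| ≤ C * (volume K.carrier).toReal ^ γ

/-! ### The fractional Brownian sheet -/

/-- The covariance of the fractional Brownian motion of Hurst index `h`. -/
def phi (h t t' : ℝ) : ℝ := (|t| ^ (2 * h) + |t'| ^ (2 * h) - |t - t'| ^ (2 * h)) / 2

/-- `W` is a fractional Brownian sheet on `[0,1]^d` of Hurst multiparameter `H`: a centered
Gaussian process with covariance `∏ φ^{H_i}(t_i, t_i')`. -/
structure IsFractionalBrownianSheet {d : ℕ} {Ω : Type*} [MeasurableSpace Ω] (H : Fin d → ℝ)
    (W : cube d → Ω → ℝ) (P : Measure Ω) : Prop where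
  gaussian : IsGaussianProcess W P
  centered : ∀ t, ∫ ω, W t ω ∂P = 0
  covariance : ∀ t t' : cube d,
    ∫ ω, W t ω * W t' ω ∂P = ∏ i, phi (H i) ((t : Fin d → ℝ) i) ((t' : Fin d → ℝ) i)

end FBS

end

/-!
Let `g_n` be the dyadic step function whose value on a dyadic cube `K` of side `2^{-n}` is
`Δ_f(K) / |K|`. If `|Δ_f(K)| ≤ C |K|^γ`, then `|g_n| ≤ C 2^{nd(1-γ)}`. The difference
`g_{n+1} - g_n` has mean zero on every dyadic cube of side `2^{-n}`, so a Poincaré inequality gains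
a factor `2^{-n}`: in the dual of `BV`, the functionals `u ↦ ∫ g_n u` form a Cauchy sequence as
soon as `2^{d(1-γ)} < 2`, which is `γ > (d-1)/d`. Their limit is a strong charge. It agrees with
`Δ_f` on dyadic rectangles, because it does so along the sequence, and on all rectangles by
continuity of `f` and of the charge.

The increment of the fractional Brownian sheet on a rectangle `∏ [a_i, b_i]` is a centered Gaussian
variable of variance `∏ (b_i - a_i)^{2 H_i}`, which is `|K|^{2 H̄}` on a dyadic cube `K`. There are
`2^{nd}` dyadic cubes of side `2^{-n}`, so for `γ < H̄` and large `p` the `p`-th moments of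
`|K|^{-γ} Δ(K)` have a finite sum over all dyadic cubes: almost surely all these ratios are bounded
by one constant.
-/

noncomputable section

namespace FBS

section Duality

variable {E F : Type*} [NormedAddCommGroup E] [NormedSpace ℝ E] [FiniteDimensional ℝ E]
  [MeasurableSpace E] [BorelSpace E] {μ : Measure E} [μ.IsAddHaarMeasure]
  [NormedAddCommGroup F] [NormedSpace ℝ F] [CompleteSpace F]

open scoped ContDiff Convolution

theorem exists_contDiff_tendsto_ae {s : E → F} (hs : AEStronglyMeasurable s μ)
    (hsc : HasCompactSupport s) {C : ℝ} (hC : ∀ x, ‖s x‖ ≤ C) :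
    ∃ ψ : ℕ → E → F, (∀ n, ContDiff ℝ ∞ (ψ n) ∧ HasCompactSupport (ψ n) ∧ ∀ x, ‖ψ n x‖ ≤ C) ∧
      ∀ᵐ x ∂μ, Filter.Tendsto (fun n => ψ n x) Filter.atTop (𝓝 (s x)) := by
  have hsl : LocallyIntegrable s μ :=
    (locallyIntegrable_const C).mono hs (ae_of_all _ fun x => (hC x).trans (le_abs_self C))
  let φ : ℕ → ContDiffBump (0 : E) := fun n =>
    { rIn := 1 / ((n : ℝ) + 1)
      rOut := 2 * (1 / ((n : ℝ) + 1))
      rIn_pos := by positivity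
      rIn_lt_rOut := lt_mul_of_one_lt_left (by positivity) one_lt_two }
  have hφ : Filter.Tendsto (fun n => (φ n).rOut) Filter.atTop (𝓝 0) := by
    rw [← mul_zero 2]
    exact tendsto_one_div_add_atTop_nhds_zero_nat.const_mul 2
  refine ⟨fun n => (φ n).normed μ ⋆[ContinuousLinearMap.lsmul ℝ ℝ, μ] s, fun n => ⟨?_, ?_, ?_⟩,
    ContDiffBump.ae_convolution_tendsto_right_of_locallyIntegrable hφ
      (.of_forall fun n => le_rfl) hsl⟩
  · exact (φ n).hasCompactSupport_normed.contDiff_convolution_left _ (φ n).contDiff_normed hsl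
  · exact (φ n).hasCompactSupport_normed.convolution _ hsc
  · intro x
    calc ‖((φ n).normed μ ⋆[ContinuousLinearMap.lsmul ℝ ℝ, μ] s) x‖
        ≤ ∫ t, (φ n).normed μ t * C ∂μ := by
          refine norm_integral_le_of_norm_le ((φ n).integrable_normed.mul_const C)
            (ae_of_all _ fun t => ?_)
          rw [ContinuousLinearMap.lsmul_apply, norm_smul,
            Real.norm_of_nonneg ((φ n).nonneg_normed t)]
          exact mul_le_mul_of_nonneg_left (hC _) ((φ n).nonneg_normed t)
      _ = C := by rw [integral_mul_const, (φ n).integral_normed, one_mul]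

theorem integral_mul_le_of_forall_contDiff {w : E → ℝ} (hw : Integrable w μ) {A : ℝ}
    (h : ∀ ψ : E → ℝ, ContDiff ℝ ∞ ψ → HasCompactSupport ψ → (∀ x, |ψ x| ≤ 1) →
      ∫ x, w x * ψ x ∂μ ≤ A)
    {s : E → ℝ} (hs : AEStronglyMeasurable s μ) (hsc : HasCompactSupport s)
    (hs1 : ∀ x, |s x| ≤ 1) : ∫ x, w x * s x ∂μ ≤ A := by
  obtain ⟨ψ, hψ, hlim⟩ := exists_contDiff_tendsto_ae hs hsc hs1
  have hint : Filter.Tendsto (fun n => ∫ x, w x * ψ n x ∂μ) Filter.atTop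
      (𝓝 (∫ x, w x * s x ∂μ)) := by
    refine tendsto_integral_of_dominated_convergence (fun x => |w x|)
      (fun n => hw.aestronglyMeasurable.mul (hψ n).1.continuous.aestronglyMeasurable) hw.abs
      (fun n => ae_of_all _ fun x => ?_) (hlim.mono fun x hx => hx.const_mul _)
    rw [norm_mul]
    exact mul_le_of_le_one_right (abs_nonneg _) ((hψ n).2.2 x)
  exact le_of_tendsto' hint fun n => h _ (hψ n).1 (hψ n).2.1 (hψ n).2.2

theorem integral_abs_le_of_forall_contDiff {w : E → ℝ} (hw : Integrable w μ) {A : ℝ}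
    (h : ∀ ψ : E → ℝ, ContDiff ℝ ∞ ψ → HasCompactSupport ψ → (∀ x, |ψ x| ≤ 1) →
      ∫ x, w x * ψ x ∂μ ≤ A) : ∫ x, |w x| ∂μ ≤ A := by
  refine le_of_tendsto' ((aecover_ball (μ := μ) (x := (0 : E))
    tendsto_natCast_atTop_atTop).integral_tendsto_of_countably_generated hw.abs) fun R => ?_
  let s : E → ℝ := (Metric.ball 0 (R : ℝ)).indicator fun x => w x / |w x|
  have hs : AEStronglyMeasurable s μ :=
    ((hw.aemeasurable.div hw.abs.aemeasurable).indicator measurableSet_ball).aestronglyMeasurable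
  have hsc : HasCompactSupport s := HasCompactSupport.intro (isCompact_closedBall 0 (R : ℝ))
    fun x hx => Set.indicator_of_notMem (fun h => hx (Metric.ball_subset_closedBall h)) _
  have hs1 : ∀ x, |s x| ≤ 1 := fun x => by
    refine (norm_indicator_le_norm_self (fun x => w x / |w x|) x).trans ?_
    rw [norm_div, Real.norm_eq_abs, Real.norm_eq_abs, abs_abs]
    exact div_self_le_one _
  have hws : ∀ x, w x * s x = (Metric.ball (0 : E) (R : ℝ)).indicator (fun x => |w x|) x := by
    intro x
    rw [← Set.indicator_mul_right]
    congr 1 with x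
    rw [← mul_div_assoc, ← abs_mul_abs_self, mul_self_div_self]
  calc ∫ x in Metric.ball 0 (R : ℝ), |w x| ∂μ = ∫ x, w x * s x ∂μ := by
        rw [← integral_indicator measurableSet_ball]
        exact integral_congr_ae (ae_of_all _ fun x => (hws x).symm)
    _ ≤ A := integral_mul_le_of_forall_contDiff hw h hs hsc hs1

end Duality

section Variation

variable {d : ℕ} {u ψ : (Fin d → ℝ) → ℝ}

theorem integral_mul_divergence_le (hu : variation u < ∞)
    {v : (Fin d → ℝ) → EuclideanSpace ℝ (Fin d)} (hv : IsTestField v) :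
    ∫ x, u x * divergence v x ≤ (variation u).toReal :=
  (ENNReal.ofReal_le_iff_le_toReal hu.ne).1 (le_iSup₂ (f := fun v (_ : IsTestField v) =>
    ENNReal.ofReal (∫ x, u x * divergence v x)) v hv)

theorem divergence_const_smul {v : (Fin d → ℝ) → EuclideanSpace ℝ (Fin d)}
    (hv : Differentiable ℝ v) (c : ℝ) (x : Fin d → ℝ) :
    divergence (c • v) x = c * divergence v x := by
  simp only [divergence, fderiv_const_smul (hv x), _root_.smul_apply,
    PiLp.smul_apply, smul_eq_mul, Finset.mul_sum]

theorem integral_mul_divergence_le_mul (hu : variation u < ∞)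
    {v : (Fin d → ℝ) → EuclideanSpace ℝ (Fin d)} (hv : ContDiff ℝ 1 v) (hvc : HasCompactSupport v)
    {M : ℝ} (hvM : ∀ x, ‖v x‖ ≤ M) :
    ∫ x, u x * divergence v x ≤ M * (variation u).toReal := by
  rcases ((norm_nonneg _).trans (hvM 0)).eq_or_lt with rfl | hM
  · have : v = 0 := funext fun x => norm_le_zero_iff.1 (hvM x)
    simp [this, divergence]
  have hw : IsTestField (M⁻¹ • v) := by
    refine ⟨contDiff_const.smul hv, hvc.smul_left (f := fun _ => M⁻¹), fun x => ?_⟩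
    rw [Pi.smul_apply, norm_smul, norm_inv, Real.norm_of_nonneg hM.le, inv_mul_le_iff₀ hM, mul_one]
    exact hvM x
  have h := integral_mul_divergence_le hu hw
  simp only [divergence_const_smul (hv.differentiable one_ne_zero), mul_left_comm _ M⁻¹,
    integral_const_mul] at h
  rwa [inv_mul_le_iff₀ hM] at h

theorem divergence_smul_const (hψ : Differentiable ℝ ψ) (τ x : Fin d → ℝ) :
    divergence (fun y => ψ y • WithLp.toLp 2 τ) x = fderiv ℝ ψ x τ := by
  have h : fderiv ℝ (fun y => ψ y • WithLp.toLp 2 τ) x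
      = (fderiv ℝ ψ x).smulRight (WithLp.toLp 2 τ) := fderiv_smul_const (hψ x) _
  calc divergence (fun y => ψ y • WithLp.toLp 2 τ) x
      = ∑ i, fderiv ℝ ψ x (Pi.single i 1) * τ i := by
        simp only [divergence, h, ContinuousLinearMap.smulRight_apply, PiLp.smul_apply, smul_eq_mul]
    _ = fderiv ℝ ψ x τ := by
        conv_rhs => rw [pi_eq_sum_univ' τ, map_sum]
        simp only [map_smul, smul_eq_mul, mul_comm]

theorem abs_integral_mul_fderiv_le (hu : variation u < ∞) (hψ : ContDiff ℝ 1 ψ)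
    (hψc : HasCompactSupport ψ) (hψ1 : ∀ x, |ψ x| ≤ 1) (τ : Fin d → ℝ) :
    |∫ x, u x * fderiv ℝ ψ x τ| ≤ ‖WithLp.toLp 2 τ‖ * (variation u).toReal := by
  have key : ∀ τ : Fin d → ℝ,
      ∫ x, u x * fderiv ℝ ψ x τ ≤ ‖WithLp.toLp 2 τ‖ * (variation u).toReal := fun τ => by
    have h := integral_mul_divergence_le_mul hu (v := fun x => ψ x • WithLp.toLp 2 τ)
      (hψ.smul contDiff_const) hψc.smul_right (M := ‖WithLp.toLp 2 τ‖) fun x => by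
        rw [norm_smul]
        exact mul_le_of_le_one_left (norm_nonneg _) (hψ1 _)
    simpa only [divergence_smul_const (hψ.differentiable one_ne_zero)] using h
  refine abs_le'.2 ⟨key τ, ?_⟩
  have h := key (-τ)
  simpa only [map_neg, mul_neg, integral_neg, WithLp.toLp_neg, norm_neg] using h

open scoped Convolution in
theorem hasDerivAt_integral_mul_comp_add_smul (hui : Integrable u) (hψ : ContDiff ℝ 1 ψ)
    (hψc : HasCompactSupport ψ) (τ : Fin d → ℝ) (t : ℝ) :
    HasDerivAt (fun t : ℝ => ∫ x, u x * ψ (x + t • τ))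
      (∫ x, u x * fderiv ℝ ψ (x + t • τ) τ) t := by
  let ψ' : (Fin d → ℝ) → ℝ := fun x => ψ (-x)
  have hconv : ∀ y, (u ⋆[ContinuousLinearMap.mul ℝ ℝ] ψ') (-y) = ∫ x, u x * ψ (x + y) := fun y => by
    simp only [convolution_def, ContinuousLinearMap.mul_apply', ψ', sub_eq_add_neg, neg_add_rev,
      neg_neg]
  have hψ' : ContDiff ℝ 1 ψ' := hψ.comp contDiff_neg
  have hψ'c : HasCompactSupport ψ' := hψc.comp_homeomorph (Homeomorph.neg _)
  have hfderiv : ∀ y, fderiv ℝ ψ' y (-τ) = fderiv ℝ ψ (-y) τ := fun y => by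
    have h := (hψ.differentiable one_ne_zero (-y)).hasFDerivAt.comp y (hasFDerivAt_id y).fun_neg
    exact (DFunLike.congr_fun h.fderiv (-τ)).trans (by simp)
  have hline : HasDerivAt (fun t : ℝ => -(t • τ)) (-τ) t := by
    simpa only [id_eq, one_smul] using ((hasDerivAt_id t).smul_const τ).fun_neg
  have h := (hψ'c.hasFDerivAt_convolution_right (ContinuousLinearMap.mul ℝ ℝ)
      hui.locallyIntegrable hψ' (-(t • τ))).comp_hasDerivAt t hline
  simp only [Function.comp_def, hconv] at h
  refine h.congr_deriv ?_
  rw [convolution_precompR_apply _ hui.locallyIntegrable (hψ'c.fderiv (𝕜 := ℝ))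
    (hψ'.continuous_fderiv one_ne_zero)]
  simp only [convolution_def, ContinuousLinearMap.mul_apply', hfderiv, sub_eq_add_neg,
    neg_add_rev, neg_neg]

theorem abs_integral_mul_translate_sub_le (hui : Integrable u) (hu : variation u < ∞)
    (hψ : ContDiff ℝ 1 ψ) (hψc : HasCompactSupport ψ) (hψ1 : ∀ x, |ψ x| ≤ 1) (τ : Fin d → ℝ) :
    |(∫ x, u x * ψ (x + τ)) - ∫ x, u x * ψ x| ≤ ‖WithLp.toLp 2 τ‖ * (variation u).toReal := by
  have hbound : ∀ t : ℝ, ‖∫ x, u x * fderiv ℝ ψ (x + t • τ) τ‖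
      ≤ ‖WithLp.toLp 2 τ‖ * (variation u).toReal := fun t => by
    have h := abs_integral_mul_fderiv_le hu (ψ := fun x => ψ (x + t • τ)) (hψ.comp (by fun_prop))
      (hψc.comp_homeomorph (Homeomorph.addRight (t • τ))) (fun x => hψ1 _) τ
    simpa only [fderiv_comp_add_right, Real.norm_eq_abs] using h
  simpa using Convex.norm_image_sub_le_of_norm_hasDerivWithin_le (s := Set.univ)
    (fun t _ => (hasDerivAt_integral_mul_comp_add_smul hui hψ hψc τ t).hasDerivWithinAt)
    (fun t _ => hbound t) convex_univ (Set.mem_univ (0 : ℝ)) (Set.mem_univ (1 : ℝ))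

theorem integral_abs_translate_sub_le (hui : Integrable u) (hu : variation u < ∞)
    (τ : Fin d → ℝ) : ∫ x, |u (x + τ) - u x| ≤ ‖WithLp.toLp 2 τ‖ * (variation u).toReal := by
  refine integral_abs_le_of_forall_contDiff ((hui.comp_add_right τ).sub hui) fun ψ hψ hψc hψ1 => ?_
  have hψ1' : ContDiff ℝ 1 ψ := hψ.of_le (by norm_num)
  have hint : ∀ y, Integrable fun x => u (x + y) * ψ x := fun y =>
    (hui.comp_add_right y).mul_bdd hψ.continuous.aestronglyMeasurable (ae_of_all _ hψ1)
  calc ∫ x, (u (x + τ) - u x) * ψ x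
      = (∫ x, u (x + τ) * ψ x) - ∫ x, u x * ψ x := by
        simp only [sub_mul]
        exact integral_sub (hint τ) (by simpa using hint 0)
    _ = (∫ x, u x * ψ (x + -τ)) - ∫ x, u x * ψ x := by
        rw [← integral_add_right_eq_self (fun x => u x * ψ (x + -τ)) τ]
        simp only [add_neg_cancel_right]
    _ ≤ ‖WithLp.toLp 2 (-τ)‖ * (variation u).toReal :=
        (le_abs_self _).trans (abs_integral_mul_translate_sub_le hui hu hψ1' hψc hψ1 (-τ))
    _ = ‖WithLp.toLp 2 τ‖ * (variation u).toReal := by rw [WithLp.toLp_neg, norm_neg]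

theorem sum_abs_setIntegral_translate_sub_le (hui : Integrable u) (hu : variation u < ∞)
    {κ : Type*} (S : Finset κ) {A : κ → Set (Fin d → ℝ)} (hA : ∀ k ∈ S, MeasurableSet (A k))
    (hdisj : (S : Set κ).PairwiseDisjoint A) (τ : Fin d → ℝ) :
    ∑ k ∈ S, |(∫ x in A k, u (x + τ)) - ∫ x in A k, u x|
      ≤ ‖WithLp.toLp 2 τ‖ * (variation u).toReal := by
  have hw : Integrable fun x => |u (x + τ) - u x| := ((hui.comp_add_right τ).sub hui).abs
  calc ∑ k ∈ S, |(∫ x in A k, u (x + τ)) - ∫ x in A k, u x|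
      ≤ ∑ k ∈ S, ∫ x in A k, |u (x + τ) - u x| := by
        refine Finset.sum_le_sum fun k _ => ?_
        rw [← integral_sub (hui.comp_add_right τ).integrableOn hui.integrableOn]
        exact abs_integral_le_integral_abs
    _ = ∫ x in ⋃ k ∈ S, A k, |u (x + τ) - u x| :=
        (integral_biUnion_finset S hA hdisj fun k _ => hw.integrableOn).symm
    _ ≤ ∫ x, |u (x + τ) - u x| := setIntegral_le_integral hw (ae_of_all _ fun x => abs_nonneg _)
    _ ≤ ‖WithLp.toLp 2 τ‖ * (variation u).toReal := integral_abs_translate_sub_le hui hu τ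

end Variation

section BoxIncrement

variable {ι α R : Type*} [Fintype ι] [DecidableEq ι] [CommRing R]

/-- The alternating sum of `F` over the vertices of the box `[p, q]` of a product `ι → α`, with the
sign `(-1)` to the number of coordinates taken from `p`. On `[0,1]^d` it is `increment`; this
version also covers functions of grid indices. -/
def boxIncrement (F : (ι → α) → R) (p q : ι → α) : R :=
  ∑ s : Finset ι, (-1) ^ s.card * F (s.piecewise p q)

theorem boxIncrement_prod (G : ι → α → R) (p q : ι → α) :
    boxIncrement (fun x => ∏ i, G i (x i)) p q = ∏ i, (G i (q i) - G i (p i)) := by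
  rw [boxIncrement, Finset.prod_sub, Finset.powerset_univ]
  refine Finset.sum_congr rfl fun s _ => ?_
  have hG : ∀ i, G i (s.piecewise p q i)
      = s.piecewise (fun i => G i (p i)) (fun i => G i (q i)) i :=
    fun i => apply_ite (G i) (i ∈ s) (p i) (q i)
  simp only [hG]
  rw [Finset.prod_piecewise, Finset.univ_inter]
  ring

theorem boxIncrement_eq_sum_piFinset [DecidableEq α] (F : (ι → α) → R) {B : ι → Finset α}
    {p q : ι → α} (hp : ∀ i, p i ∈ B i) (hq : ∀ i, q i ∈ B i) :
    boxIncrement F p q = ∑ c ∈ Fintype.piFinset B,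
      F c * ∏ i, ((if q i = c i then 1 else 0) - if p i = c i then 1 else 0) := by
  have hF : ∀ x ∈ Fintype.piFinset B,
      F x = ∑ c ∈ Fintype.piFinset B, F c * ∏ i, if x i = c i then 1 else 0 := fun x hx => by
    simp only [Fintype.prod_ite_zero, Finset.prod_const_one, ← funext_iff, mul_ite, mul_one,
      mul_zero, Finset.sum_ite_eq, if_pos hx]
  have hmem : ∀ s : Finset ι, s.piecewise p q ∈ Fintype.piFinset B := fun s =>
    Fintype.mem_piFinset.2 fun i => s.piecewise_cases p q (· ∈ B i) (hp i) (hq i)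
  calc boxIncrement F p q = ∑ s : Finset ι, ∑ c ∈ Fintype.piFinset B,
        F c * ((-1) ^ s.card * ∏ i, if s.piecewise p q i = c i then 1 else 0) := by
        refine Finset.sum_congr rfl fun s _ => ?_
        rw [hF _ (hmem s), Finset.mul_sum]
        exact Finset.sum_congr rfl fun c _ => mul_left_comm _ _ _
    _ = _ := by
        rw [Finset.sum_comm]
        refine Finset.sum_congr rfl fun c _ => ?_
        rw [← Finset.mul_sum]
        exact congrArg _ (boxIncrement_prod (fun i x => if x = c i then 1 else 0) p q)

theorem sum_boxIncrement_piFinset_Ico (F : (ι → ℕ) → R) {p q : ι → ℕ} (hpq : p ≤ q) :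
    ∑ k ∈ Fintype.piFinset (fun i => Finset.Ico (p i) (q i)), boxIncrement F k (k + 1)
      = boxIncrement F p q := by
  have hcell : ∀ k ∈ Fintype.piFinset (fun i => Finset.Ico (p i) (q i)),
      boxIncrement F k (k + 1) = ∑ c ∈ Fintype.piFinset (fun i => Finset.Icc (p i) (q i)),
        F c * ∏ i, ((if k i + 1 = c i then 1 else 0) - if k i = c i then 1 else 0) := by
    intro k hk
    have hk' := fun i => Finset.mem_Ico.1 (Fintype.mem_piFinset.1 hk i)
    exact boxIncrement_eq_sum_piFinset F (fun i => Finset.mem_Icc.2 ⟨(hk' i).1, (hk' i).2.le⟩)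
      fun i => Finset.mem_Icc.2 ⟨(hk' i).1.trans (Nat.le_succ _), (hk' i).2⟩
  rw [boxIncrement_eq_sum_piFinset F (fun i => Finset.left_mem_Icc.2 (hpq i))
    (fun i => Finset.right_mem_Icc.2 (hpq i)), Finset.sum_congr rfl hcell, Finset.sum_comm]
  refine Finset.sum_congr rfl fun c _ => ?_
  rw [← Finset.mul_sum, ← Finset.prod_univ_sum (fun i => Finset.Ico (p i) (q i)) fun i n =>
    (if n + 1 = c i then 1 else 0) - if n = c i then 1 else 0]
  congr 1
  exact Finset.prod_congr rfl fun i _ =>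
    Finset.sum_Ico_sub (fun n => if n = c i then (1 : R) else 0) (hpq i)

end BoxIncrement

section Grid

variable {d : ℕ} {f : cube d → ℝ} {n : ℕ} {k : Fin d → ℕ}

/-- The point of `[0,1]^d` with coordinates `k_i / 2^n`, truncated at `1` so that it is defined for
all `k`. -/
def gridPt (n : ℕ) (k : Fin d → ℕ) : cube d :=
  ⟨fun i => min ((k i : ℝ) / 2 ^ n) 1, fun i => le_min (by positivity) zero_le_one,
    fun _ => min_le_right _ _⟩

theorem gridPt_apply (hk : ∀ i, k i ≤ 2 ^ n) (i : Fin d) :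
    (gridPt n k : Fin d → ℝ) i = (k i : ℝ) / 2 ^ n := by
  refine min_eq_left ?_
  rw [div_le_one (by positivity)]
  exact_mod_cast hk i

theorem gridPt_add (n m : ℕ) (k : Fin d → ℕ) :
    gridPt (n + m) (fun i => 2 ^ m * k i) = gridPt n k := by
  refine Subtype.ext (funext fun i => congrArg (min · 1) ?_)
  push_cast
  rw [pow_add, mul_comm (2 ^ n : ℝ), mul_div_mul_left _ _ (by positivity)]

theorem gridPt_mono (n : ℕ) : Monotone (gridPt n : (Fin d → ℕ) → cube d) := fun k l hkl i =>
  min_le_min_right 1 (div_le_div_of_nonneg_right (Nat.cast_le.2 (hkl i)) (by positivity))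

theorem increment_gridPt (f : cube d → ℝ) (n : ℕ) (p q : Fin d → ℕ) :
    increment f (gridPt n p) (gridPt n q) = boxIncrement (fun k => f (gridPt n k)) p q := by
  refine Finset.sum_congr rfl fun s _ => ?_
  have : vertex (gridPt n p) (gridPt n q) s = gridPt n (s.piecewise p q) :=
    Subtype.ext (funext fun i =>
      (apply_ite (fun k : ℕ => min ((k : ℝ) / 2 ^ n) 1) (i ∈ s) (p i) (q i)).symm)
  rw [this]

/-- The increment of `f` on the dyadic cube `∏ [2^{-n} k_i, 2^{-n} (k_i + 1)]`. -/
def cellIncr (f : cube d → ℝ) (n : ℕ) (k : Fin d → ℕ) : ℝ :=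
  increment f (gridPt n k) (gridPt n (k + 1))

theorem sum_cellIncr_piFinset_Ico (f : cube d → ℝ) (n : ℕ) {p q : Fin d → ℕ} (hpq : p ≤ q) :
    ∑ k ∈ Fintype.piFinset (fun i => Finset.Ico (p i) (q i)), cellIncr f n k
      = increment f (gridPt n p) (gridPt n q) := by
  simp only [cellIncr, increment_gridPt]
  exact sum_boxIncrement_piFinset_Ico (fun k => f (gridPt n k)) hpq

/-- The indices of the dyadic cubes of generation `n`. -/
def grid (d n : ℕ) : Finset (Fin d → ℕ) := Fintype.piFinset fun _ => Finset.range (2 ^ n)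

theorem mem_grid : k ∈ grid d n ↔ ∀ i, k i < 2 ^ n := by
  simp only [grid, Fintype.mem_piFinset, Finset.mem_range]

/-- The index of the child in position `e` of the dyadic cube with index `k`. -/
def child (k : Fin d → ℕ) (e : Fin d → Fin 2) : Fin d → ℕ := fun i => 2 * k i + e i

theorem child_injective (k : Fin d → ℕ) : Function.Injective (child k) := fun _ _ h =>
  funext fun i => Fin.ext (Nat.add_left_cancel (congrFun h i))

theorem exists_child_eq_iff {l : Fin d → ℕ} : (∃ e, child k e = l) ↔ ∀ i, l i / 2 = k i := by
  constructor
  · rintro ⟨e, rfl⟩ i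
    simp only [child]
    omega
  · intro h
    refine ⟨fun i => ⟨l i % 2, Nat.mod_lt _ two_pos⟩, funext fun i => ?_⟩
    rw [child, ← h i, Nat.div_add_mod]

theorem child_mem_grid (hk : k ∈ grid d n) (e : Fin d → Fin 2) : child k e ∈ grid d (n + 1) := by
  refine mem_grid.2 fun i => ?_
  have := mem_grid.1 hk i
  rw [child, pow_succ]
  omega

theorem sum_grid_succ (g : (Fin d → ℕ) → ℝ) :
    ∑ l ∈ grid d (n + 1), g l = ∑ k ∈ grid d n, ∑ e, g (child k e) := by
  have hmaps : ∀ l ∈ grid d (n + 1), (fun i => l i / 2) ∈ grid d n := fun l hl =>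
    mem_grid.2 fun i => Nat.div_lt_of_lt_mul (by rw [← pow_succ']; exact mem_grid.1 hl i)
  rw [← Finset.sum_fiberwise_of_maps_to hmaps]
  refine Finset.sum_congr rfl fun k hk => ?_
  have hfiber : {l ∈ grid d (n + 1) | (fun i => l i / 2) = k} = Finset.univ.image (child k) := by
    ext l
    simp only [Finset.mem_filter, Finset.mem_image, Finset.mem_univ, true_and,
      exists_child_eq_iff, funext_iff (f := fun i => l i / 2), and_iff_right_iff_imp]
    intro h
    obtain ⟨e, rfl⟩ := exists_child_eq_iff.2 h
    exact child_mem_grid hk e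
  rw [hfiber, Finset.sum_image (child_injective k).injOn]

theorem sum_cellIncr_child (f : cube d → ℝ) (n : ℕ) (k : Fin d → ℕ) :
    ∑ e, cellIncr f (n + 1) (child k e) = cellIncr f n k := by
  have himage : Finset.univ.image (child k)
      = Fintype.piFinset (fun i => Finset.Ico (2 * k i) (2 * (k + 1) i)) := by
    ext l
    simp only [Finset.mem_image, Finset.mem_univ, true_and, exists_child_eq_iff,
      Fintype.mem_piFinset, Finset.mem_Ico, Pi.add_apply, Pi.one_apply]
    exact forall_congr' fun i => by omega
  have hle : (fun i => 2 * k i) ≤ fun i => 2 * (k + 1) i :=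
    fun i => Nat.mul_le_mul_left 2 (Nat.le_add_right (k i) 1)
  calc ∑ e, cellIncr f (n + 1) (child k e)
      = increment f (gridPt (n + 1) fun i => 2 * k i)
          (gridPt (n + 1) fun i => 2 * (k + 1) i) := by
        rw [← Finset.sum_image (f := cellIncr f (n + 1)) (child_injective k).injOn, himage,
          sum_cellIncr_piFinset_Ico f (n + 1) hle]
    _ = cellIncr f n k := by
        rw [cellIncr, ← gridPt_add n 1 k, ← gridPt_add n 1 (k + 1), pow_one]

end Grid

section Cells

variable {d n : ℕ} {k l : Fin d → ℕ} {u : (Fin d → ℝ) → ℝ}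

/-- The half-open dyadic cube `∏ [2^{-n} k_i, 2^{-n} (k_i + 1))`. Half-open cubes of the same
generation are disjoint, and not only almost disjoint. -/
def cell (n : ℕ) (k : Fin d → ℕ) : Set (Fin d → ℝ) :=
  Set.univ.pi fun i => Set.Ico ((k i : ℝ) / 2 ^ n) (((k i : ℝ) + 1) / 2 ^ n)

theorem mem_cell_iff_floor {x : Fin d → ℝ} : x ∈ cell n k ↔ ∀ i, ⌊2 ^ n * x i⌋ = (k i : ℤ) := by
  have hp : (0 : ℝ) < 2 ^ n := by positivity
  simp only [cell, Set.mem_univ_pi, Set.mem_Ico, Int.floor_eq_iff]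
  refine forall_congr' fun i => ?_
  rw [div_le_iff₀ hp, lt_div_iff₀ hp, mul_comm, Int.cast_natCast]

theorem measurableSet_cell (n : ℕ) (k : Fin d → ℕ) : MeasurableSet (cell n k) :=
  MeasurableSet.univ_pi fun _ => measurableSet_Ico

theorem disjoint_cell (h : k ≠ l) : Disjoint (cell n k) (cell n l) := by
  refine Set.disjoint_left.2 fun x hk hl => h (funext fun i => ?_)
  exact_mod_cast (mem_cell_iff_floor.1 hk i).symm.trans (mem_cell_iff_floor.1 hl i)

theorem volume_real_cell (n : ℕ) (k : Fin d → ℕ) :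
    volume.real (cell n k) = (2 ^ (n * d) : ℝ)⁻¹ := by
  have : ∀ i, (k i : ℝ) / 2 ^ n ≤ ((k i : ℝ) + 1) / 2 ^ n := fun i => by gcongr; linarith
  rw [Measure.real, cell, Real.volume_pi_Ico_toReal this]
  simp only [← sub_div, add_sub_cancel_left, Finset.prod_const, Finset.card_univ,
    Fintype.card_fin, one_div, inv_pow, pow_mul]

theorem cell_subset_cube (hk : k ∈ grid d n) : cell n k ⊆ cube d := by
  intro x hx
  have hx' := fun i => Set.mem_univ_pi.1 hx i
  refine ⟨fun i => le_trans (by positivity) (hx' i).1, fun i => (hx' i).2.le.trans ?_⟩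
  rw [Pi.one_apply, div_le_one (by positivity)]
  exact_mod_cast mem_grid.1 hk i

theorem cell_eq_iUnion_child (n : ℕ) (k : Fin d → ℕ) :
    cell n k = ⋃ e, cell (n + 1) (child k e) := by
  ext x
  have hfloor : ∀ i, ⌊2 ^ n * x i⌋ = ⌊2 ^ (n + 1) * x i⌋ / 2 := fun i => by
    rw [← Nat.cast_ofNat (R := ℤ), ← Int.floor_div_natCast, pow_succ]
    congr 1
    push_cast
    ring
  simp only [Set.mem_iUnion, mem_cell_iff_floor, hfloor]
  constructor
  · intro h
    obtain ⟨e, he⟩ := (exists_child_eq_iff (k := k)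
      (l := fun i => ⌊2 ^ (n + 1) * x i⌋.toNat)).2 fun i => by have := h i; omega
    refine ⟨e, fun i => ?_⟩
    have := h i
    simp only [he]
    omega
  · rintro ⟨e, h⟩ i
    have := (exists_child_eq_iff (k := k)).1 ⟨e, rfl⟩ i
    have := h i
    omega

theorem setIntegral_cell_eq_sum_child (k : Fin d → ℕ) (hu : Integrable u) :
    ∫ x in cell n k, u x = ∑ e, ∫ x in cell (n + 1) (child k e), u x := by
  rw [cell_eq_iUnion_child]
  exact integral_iUnion_fintype (fun e => measurableSet_cell _ _)
    (fun e e' h => disjoint_cell ((child_injective k).ne h)) fun e => hu.integrableOn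

theorem setIntegral_cell_add (n : ℕ) (k l : Fin d → ℕ) (u : (Fin d → ℝ) → ℝ) :
    ∫ x in cell n (k + l), u x
      = ∫ x in cell n k, u (x + (2 ^ n : ℝ)⁻¹ • fun i => (l i : ℝ)) := by
  have hpre : (· + (2 ^ n : ℝ)⁻¹ • fun i => (l i : ℝ)) ⁻¹' cell n (k + l) = cell n k := by
    ext x
    simp only [Set.mem_preimage, mem_cell_iff_floor, Pi.add_apply, Pi.smul_apply, smul_eq_mul]
    refine forall_congr' fun i => ?_
    rw [mul_add, mul_inv_cancel_left₀ (by positivity), Int.floor_add_natCast, Nat.cast_add,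
      add_left_inj]
  rw [← hpre]
  exact ((measurePreserving_add_right volume _).setIntegral_preimage_emb
    (MeasurableEquiv.addRight _).measurableEmbedding u _).symm

end Cells

section Functionals

variable {d : ℕ}

theorem BVCube.integrable (u : BVCube d) : Integrable u := L1.integrable_coeFn _

theorem BVCube.norm_toL1_le (u : BVCube d) : ‖BVCube.toL1 u‖ ≤ ‖u‖ := by
  rw [BVCube.norm_eq]
  exact le_add_of_nonneg_right ENNReal.toReal_nonneg

theorem BVCube.variation_toReal_le_norm (u : BVCube d) : (variation u).toReal ≤ ‖u‖ := by
  rw [BVCube.norm_eq]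
  exact le_add_of_nonneg_left (norm_nonneg _)

/-- The functional `u ↦ ∫_s u` on `BV([0,1]^d)`. -/
def setIntegralDual (s : Set (Fin d → ℝ)) : StrongDual ℝ (BVCube d) :=
  L1.integralCLM.comp ((LpToLpRestrictCLM (Fin d → ℝ) ℝ ℝ volume 1 s).comp
    (BVCube.toL1.mkContinuous 1 fun u => (one_mul ‖u‖).symm ▸ u.norm_toL1_le))

theorem setIntegralDual_apply (s : Set (Fin d → ℝ)) (u : BVCube d) :
    setIntegralDual s u = ∫ x in s, u x := by
  change L1.integralCLM (LpToLpRestrictCLM (Fin d → ℝ) ℝ ℝ volume 1 s (BVCube.toL1 u)) = _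
  rw [← L1.integral_def, L1.integral_eq_integral]
  exact integral_congr_ae (LpToLpRestrictCLM_coeFn ℝ s _)

theorem sum_smul_setIntegralDual_mem_SCH {κ : Type*} (S : Finset κ) (c : κ → ℝ)
    {A : κ → Set (Fin d → ℝ)} (hA : ∀ k ∈ S, MeasurableSet (A k))
    (hAd : ∀ k ∈ S, A k ⊆ cube d) :
    ∑ k ∈ S, c k • setIntegralDual (A k) ∈ SCH d := by
  have : IsFiniteMeasure (volume.restrict (cube d)) :=
    isFiniteMeasure_restrict.2 isCompact_Icc.measure_ne_top
  refine subset_closure ⟨fun x => ∑ k ∈ S, (A k).indicator (fun _ => c k) x, ?_, fun u => ?_⟩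
  · exact memLp_finsetSum _ fun k hk => memLp_indicator_const _ (hA k hk) _
      (.inr (measure_ne_top _ _))
  · have hmul : ∀ k x, (A k).indicator (fun _ => c k) x * u x
        = (A k).indicator (fun x => c k * u x) x := fun k x =>
      (Set.indicator_mul_left (A k) (fun _ => c k) u).symm
    simp only [_root_.sum_apply, _root_.smul_apply, smul_eq_mul, Finset.sum_mul,
      setIntegralDual_apply, hmul]
    rw [integral_finsetSum _ fun k hk =>
      ((u.integrable.const_mul (c k)).indicator (hA k hk)).integrableOn]
    refine Finset.sum_congr rfl fun k hk => ?_
    rw [setIntegral_indicator (hA k hk), Set.inter_eq_right.2 (hAd k hk), integral_const_mul]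

/-- The average `Δ_f(K) / |K|` of the increments of `f` over the dyadic cube `K` with index `k` of
generation `n`; these are the values of the step densities approximating `Δ_f`. -/
def cellDensity (f : cube d → ℝ) (n : ℕ) (k : Fin d → ℕ) : ℝ :=
  2 ^ (n * d) * cellIncr f n k

theorem sum_cellDensity_child (f : cube d → ℝ) (n : ℕ) (k : Fin d → ℕ) :
    ∑ e, cellDensity f (n + 1) (child k e) = 2 ^ d * cellDensity f n k := by
  simp only [cellDensity]
  rw [← Finset.mul_sum, sum_cellIncr_child]
  ring

/-- The functional `u ↦ ∫ g_n u` on `BV([0,1]^d)`, where `g_n` is the step function equal to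
`cellDensity f n k` on the dyadic cube of generation `n` with index `k`. -/
def stepDual (f : cube d → ℝ) (n : ℕ) : StrongDual ℝ (BVCube d) :=
  ∑ k ∈ grid d n, cellDensity f n k • setIntegralDual (cell n k)

theorem stepDual_apply (f : cube d → ℝ) (n : ℕ) (u : BVCube d) :
    stepDual f n u = ∑ k ∈ grid d n, cellDensity f n k * ∫ x in cell n k, u x := by
  simp only [stepDual, _root_.sum_apply, _root_.smul_apply, smul_eq_mul,
    setIntegralDual_apply]

theorem stepDual_mem_SCH (f : cube d → ℝ) (n : ℕ) : stepDual f n ∈ SCH d :=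
  sum_smul_setIntegralDual_mem_SCH _ _ (fun k _ => measurableSet_cell n k)
    fun _ hk => cell_subset_cube hk

-- The weights `g_{n+1} - g_n` have mean zero over the children of each cube, so that the integral
-- over one fixed child may be subtracted.
theorem stepDual_succ_sub_apply (f : cube d → ℝ) (n : ℕ) (u : BVCube d) :
    (stepDual f (n + 1) - stepDual f n) u = ∑ e, ∑ k ∈ grid d n,
      (cellDensity f (n + 1) (child k e) - cellDensity f n k) *
        ((∫ x in cell (n + 1) (child k e), u x) - ∫ x in cell (n + 1) (child k 0), u x) := by
  rw [sub_apply, stepDual_apply, stepDual_apply, sum_grid_succ,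
    ← Finset.sum_sub_distrib, Finset.sum_comm]
  refine Finset.sum_congr rfl fun k _ => ?_
  have hmean : ∑ e, (cellDensity f (n + 1) (child k e) - cellDensity f n k) = 0 := by
    simp only [Finset.sum_sub_distrib, sum_cellDensity_child, Finset.sum_const, Finset.card_univ,
      Fintype.card_fun, Fintype.card_fin, nsmul_eq_mul, Nat.cast_pow, Nat.cast_ofNat, sub_self]
  simp only [mul_sub _ (∫ x in cell (n + 1) (child k _), u x)]
  rw [Finset.sum_sub_distrib, ← Finset.sum_mul, hmean, zero_mul, sub_zero,
    setIntegral_cell_eq_sum_child k u.integrable, Finset.mul_sum, ← Finset.sum_sub_distrib]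
  exact Finset.sum_congr rfl fun e _ => (sub_mul _ _ _).symm

theorem sum_abs_setIntegral_child_sub_le (n : ℕ) (e : Fin d → Fin 2) (u : BVCube d) :
    ∑ k ∈ grid d n,
        |(∫ x in cell (n + 1) (child k e), u x) - ∫ x in cell (n + 1) (child k 0), u x|
      ≤ (2 ^ (n + 1) : ℝ)⁻¹ * ‖WithLp.toLp 2 fun i => ((e i : ℕ) : ℝ)‖ * ‖u‖ := by
  have hchild : ∀ k, child k e = child k 0 + fun i => (e i : ℕ) := fun k => rfl
  simp only [hchild, setIntegral_cell_add]
  refine (sum_abs_setIntegral_translate_sub_le u.integrable u.variation_lt_top (grid d n)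
    (fun k _ => measurableSet_cell _ _) (fun k _ l _ h => disjoint_cell fun h' => h ?_) _).trans ?_
  · exact funext fun i => mul_left_cancel₀ two_ne_zero (congrFun h' i)
  · rw [WithLp.toLp_smul, norm_smul, norm_inv, norm_pow, Real.norm_ofNat]
    exact mul_le_mul_of_nonneg_left u.variation_toReal_le_norm (by positivity)

theorem norm_stepDual_succ_sub_le {f : cube d → ℝ} {C ρ : ℝ} (hC : 0 ≤ C) (hρ : 0 ≤ ρ)
    (hf : ∀ n, ∀ k ∈ grid d n, |cellDensity f n k| ≤ C * ρ ^ n) (n : ℕ) :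
    ‖stepDual f (n + 1) - stepDual f n‖
      ≤ C * (1 + ρ) / 2 * (∑ e : Fin d → Fin 2, ‖WithLp.toLp 2 fun i => ((e i : ℕ) : ℝ)‖)
          * (ρ / 2) ^ n := by
  refine ContinuousLinearMap.opNorm_le_bound _ (by positivity) fun u => ?_
  have hcoeff : ∀ e, ∀ k ∈ grid d n,
      |cellDensity f (n + 1) (child k e) - cellDensity f n k| ≤ C * (1 + ρ) * ρ ^ n :=
    fun e k hk => calc
      _ ≤ C * ρ ^ (n + 1) + C * ρ ^ n :=
        (abs_sub _ _).trans (add_le_add (hf _ _ (child_mem_grid hk e)) (hf _ _ hk))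
      _ = C * (1 + ρ) * ρ ^ n := by ring
  rw [stepDual_succ_sub_apply, Real.norm_eq_abs]
  calc _ ≤ ∑ e, ∑ k ∈ grid d n, C * (1 + ρ) * ρ ^ n *
        |(∫ x in cell (n + 1) (child k e), u x) - ∫ x in cell (n + 1) (child k 0), u x| := by
        refine (Finset.abs_sum_le_sum_abs _ _).trans (Finset.sum_le_sum fun e _ => ?_)
        refine (Finset.abs_sum_le_sum_abs _ _).trans (Finset.sum_le_sum fun k hk => ?_)
        rw [abs_mul]
        exact mul_le_mul_of_nonneg_right (hcoeff e k hk) (abs_nonneg _)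
    _ ≤ ∑ e : Fin d → Fin 2, C * (1 + ρ) * ρ ^ n *
          ((2 ^ (n + 1) : ℝ)⁻¹ * ‖WithLp.toLp 2 fun i => ((e i : ℕ) : ℝ)‖ * ‖u‖) := by
        refine Finset.sum_le_sum fun e _ => ?_
        rw [← Finset.mul_sum]
        exact mul_le_mul_of_nonneg_left (sum_abs_setIntegral_child_sub_le n e u) (by positivity)
    _ = _ := by
        rw [← Finset.mul_sum, ← Finset.sum_mul, ← Finset.mul_sum, div_pow]
        field_simp
        ring

theorem exists_tendsto_stepDual {f : cube d → ℝ} {C ρ : ℝ} (hC : 0 ≤ C) (hρ : 0 ≤ ρ)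
    (hρ2 : ρ < 2) (hf : ∀ n, ∀ k ∈ grid d n, |cellDensity f n k| ≤ C * ρ ^ n) :
    ∃ α ∈ SCH d, Filter.Tendsto (stepDual f) Filter.atTop (𝓝 α) := by
  have hdist := norm_stepDual_succ_sub_le hC hρ hf
  simp only [← dist_eq_norm, dist_comm (stepDual f (_ + 1))] at hdist
  obtain ⟨α, hα⟩ := cauchySeq_tendsto_of_complete
    (cauchySeq_of_le_geometric (ρ / 2) _ (by linarith) hdist)
  exact ⟨α, isClosed_closure.mem_of_tendsto hα (.of_forall (stepDual_mem_SCH f)), hα⟩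

end Functionals

section Charges

theorem tendsto_setIntegral_of_tendsto_measure_symmDiff {X E ι : Type*} [MeasurableSpace X]
    [NormedAddCommGroup E] [NormedSpace ℝ E] {μ : Measure X} {f : X → E} {l : Filter ι}
    {s : ι → Set X} {t : Set X} (hf : Integrable f μ) (hs : ∀ i, NullMeasurableSet (s i) μ)
    (ht : NullMeasurableSet t μ) (h : Filter.Tendsto (fun i => μ (symmDiff (s i) t)) l (𝓝 0)) :
    Filter.Tendsto (fun i => ∫ x in s i, f x ∂μ) l (𝓝 (∫ x in t, f x ∂μ)) := by
  have hsub : ∀ {u : ι → Set X}, (∀ i, u i ⊆ symmDiff (s i) t) →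
      Filter.Tendsto (fun i => ∫ x in u i, f x ∂μ) l (𝓝 0) := fun hu =>
    hf.tendsto_setIntegral_nhds_zero
      (tendsto_of_tendsto_of_tendsto_of_le_of_le tendsto_const_nhds h (fun _ => zero_le)
        fun i => measure_mono (hu i))
  have hdiff := (hsub (u := fun i => s i \ t) fun _ => Set.subset_union_left).sub
    (hsub (u := fun i => t \ s i) fun _ => Set.subset_union_right)
  rw [sub_zero] at hdiff
  refine tendsto_sub_nhds_zero_iff.1 (hdiff.congr fun i => ?_)
  rw [← integral_inter_add_sdiff₀ ht hf.integrableOn (s := s i),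
    ← integral_inter_add_sdiff₀ (hs i) hf.integrableOn (s := t), Set.inter_comm t,
    add_sub_add_left_eq_sub]

theorem isClosed_setOfPred_tendsto_apply_of_norm_le {E : Type*} [SeminormedAddCommGroup E]
    [NormedSpace ℝ E] {u : ℕ → E} {M : NNReal} (hu : ∀ n, ‖u n‖ ≤ M) (v : E) :
    IsClosed {β : StrongDual ℝ E |
      Filter.Tendsto (fun n => β (u n)) Filter.atTop (𝓝 (β v))} := by
  refine (LipschitzWith.uniformEquicontinuous (fun n (β : StrongDual ℝ E) => β (u n)) M
    fun n => LipschitzWith.of_dist_le_mul fun α β => ?_).equicontinuous.isClosed_setOfPred_tendsto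
    (ContinuousLinearMap.apply ℝ ℝ v).continuous
  rw [dist_eq_norm, dist_eq_norm, ← sub_apply, mul_comm]
  exact (α - β).le_opNorm_of_le (hu n)

variable {d : ℕ}

theorem BVCube.ext_ae {u w : BVCube d}
    (h : (u : (Fin d → ℝ) → ℝ) =ᵐ[volume] (w : (Fin d → ℝ) → ℝ)) : u = w :=
  Subtype.ext (Lp.ext h)

theorem BVSet.ind_ae_eq (B : BVSet d) :
    (B.ind : (Fin d → ℝ) → ℝ) =ᵐ[volume] B.carrier.indicator fun _ => 1 :=
  B.integrable_indicator.coeFn_toL1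

theorem BVSet.ind_eq_sum {κ : Type*} [Fintype κ] {R : κ → BVSet d} {F : BVSet d}
    (hF : F.carrier = ⋃ j, (R j).carrier)
    (hdisj : Pairwise fun j k => volume ((R j).carrier ∩ (R k).carrier) = 0) :
    F.ind = ∑ j, (R j).ind := by
  refine BVCube.ext_ae ?_
  rw [map_sum]
  have hx_disj : ∀ᵐ x, ∀ j k, j ≠ k → x ∉ (R j).carrier ∩ (R k).carrier := by
    simp only [ae_all_iff]
    exact fun j k h => measure_eq_zero_iff_ae_notMem.1 (hdisj h)
  have hR : ∀ᵐ x, ∀ j, (R j).ind x = (R j).carrier.indicator (fun _ => 1) x :=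
    ae_all_iff.2 fun j => (R j).ind_ae_eq
  filter_upwards [hx_disj, hR, F.ind_ae_eq,
    Lp.coeFn_finsetSum Finset.univ fun j => BVCube.toL1 (R j).ind] with x hx hRx hFx hsum
  rw [hFx, hsum, Finset.sum_apply, Finset.sum_congr rfl fun j _ => hRx j, hF]
  by_cases hU : ∃ j, x ∈ (R j).carrier
  · obtain ⟨j, hj⟩ := hU
    rw [Set.indicator_of_mem (Set.mem_iUnion_of_mem j hj), Fintype.sum_eq_single j,
      Set.indicator_of_mem hj]
    exact fun k hk => Set.indicator_of_notMem (fun h => hx k j hk ⟨h, hj⟩) _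
  · rw [Set.indicator_of_notMem (mt Set.mem_iUnion.1 hU), Finset.sum_eq_zero]
    exact fun j _ => Set.indicator_of_notMem (fun h => hU ⟨j, h⟩) _

theorem BVSet.setIntegral_ind (B : BVSet d) {s : Set (Fin d → ℝ)} (hs : MeasurableSet s) :
    ∫ x in s, B.ind x = volume.real (B.carrier ∩ s) := by
  rw [integral_congr_ae (ae_restrict_of_ae B.ind_ae_eq),
    integral_indicator₀ (B.nullMeasurable.mono_ac Measure.absolutelyContinuous_restrict),
    setIntegral_const, smul_eq_mul, mul_one, measureReal_restrict_apply' hs]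

theorem BVSet.setIntegral_mul_ind (B : BVSet d) (f : (Fin d → ℝ) → ℝ) :
    ∫ x in cube d, f x * B.ind x = ∫ x in B.carrier, f x ∂volume.restrict (cube d) := by
  rw [← integral_indicator₀ (B.nullMeasurable.mono_ac Measure.absolutelyContinuous_restrict)]
  refine integral_congr_ae (ae_restrict_of_ae (B.ind_ae_eq.mono fun x hx => ?_))
  simp only [hx, ← Set.indicator_mul_right, mul_one]

theorem BVSet.norm_ind_le (B : BVSet d) : ‖B.ind‖ ≤ 1 + (perimeter B.carrier).toReal := by
  have habs : ∀ᵐ x, |B.ind x| = B.ind x := by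
    filter_upwards [B.ind_ae_eq] with x hx
    rw [hx, abs_of_nonneg (Set.indicator_nonneg (fun _ _ => zero_le_one) _)]
  rw [BVCube.norm_def, variation_congr B.ind_ae_eq, integral_congr_ae habs, ← setIntegral_univ,
    B.setIntegral_ind MeasurableSet.univ, Set.inter_univ]
  refine add_le_add_left ?_ _
  refine ENNReal.toReal_le_of_le_ofReal zero_le_one ((measure_mono B.subset_cube).trans ?_)
  simp [Real.volume_Icc_pi]

theorem isCharge_of_mem_SCH (hd : 1 ≤ d) {α : StrongDual ℝ (BVCube d)} (hα : α ∈ SCH d) :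
    IsCharge fun B : BVSet d => α B.ind where
  additive B₁ B₂ B h0 hB := by
    have hsum : B.ind = ∑ j, (![B₁, B₂] j).ind := by
      refine BVSet.ind_eq_sum (by rw [hB]; ext x; simp [Fin.exists_fin_two]) ?_
      intro j k hjk
      fin_cases j <;> fin_cases k <;> simp_all [Set.inter_comm]
    rw [hsum, Fin.sum_univ_two, map_add]
    rfl
  tendsto B B' hper hvol := by
    set M : NNReal := 1 + (⨆ n, perimeter (B n).carrier).toNNReal
    have hnorm : ∀ n, ‖(B n).ind‖ ≤ M := fun n =>
      (B n).norm_ind_le.trans (add_le_add_right (ENNReal.toReal_mono hper.ne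
        (le_iSup (fun n => perimeter (B n).carrier) n)) 1)
    refine closure_minimal ?_ (isClosed_setOfPred_tendsto_apply_of_norm_le hnorm B'.ind) hα
    rintro β ⟨f, hf, hβ⟩
    have : IsFiniteMeasure (volume.restrict (cube d)) :=
      isFiniteMeasure_restrict.2 isCompact_Icc.measure_ne_top
    have hnull : ∀ A : BVSet d, NullMeasurableSet A.carrier (volume.restrict (cube d)) :=
      fun A => A.nullMeasurable.mono_ac Measure.absolutelyContinuous_restrict
    simp only [Set.mem_ofPred_eq, hβ, BVSet.setIntegral_mul_ind]
    exact tendsto_setIntegral_of_tendsto_measure_symmDiff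
      (hf.integrable (by exact_mod_cast hd)) (fun n => hnull (B n)) (hnull B')
      (tendsto_of_tendsto_of_tendsto_of_le_of_le tendsto_const_nhds hvol (fun _ => zero_le)
        fun n => Measure.restrict_apply_le _ _)

theorem isStrongCharge_of_mem_SCH (hd : 1 ≤ d) {α : StrongDual ℝ (BVCube d)} (hα : α ∈ SCH d) :
    IsStrongCharge fun B : BVSet d => α B.ind :=
  ⟨isCharge_of_mem_SCH hd hα, α, hα, fun _ => rfl⟩

end Charges

section Rectangles

theorem setIntegral_Icc_divergence {n : ℕ} {a b : Fin (n + 1) → ℝ} (hab : a ≤ b)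
    {v : (Fin (n + 1) → ℝ) → EuclideanSpace ℝ (Fin (n + 1))} (hv : IsTestField v) :
    ∫ x in Set.Icc a b, divergence v x = ∑ i : Fin (n + 1),
      ((∫ x in Set.Icc (a ∘ i.succAbove) (b ∘ i.succAbove), v (i.insertNth (b i) x) i)
        - ∫ x in Set.Icc (a ∘ i.succAbove) (b ∘ i.succAbove), v (i.insertNth (a i) x) i) :=
  integral_divergence_of_hasFDerivAt_off_countable' a b hab (fun i x => v x i)
    (fun i x => (EuclideanSpace.proj (𝕜 := ℝ) i).comp (fderiv ℝ v x)) ∅ Set.countable_empty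
    (fun i => ((EuclideanSpace.proj (𝕜 := ℝ) i).continuous.comp
      hv.contDiff.continuous).continuousOn)
    (fun x _ i => (EuclideanSpace.proj (𝕜 := ℝ) i).hasFDerivAt.comp x
      ((hv.contDiff.differentiable one_ne_zero) x).hasFDerivAt)
    (hv.continuous_divergence.continuousOn.integrableOn_compact isCompact_Icc)

theorem volume_real_Icc_le_one {d : ℕ} {a b : Fin d → ℝ} (ha : 0 ≤ a) (hb : b ≤ 1) :
    volume.real (Set.Icc a b) ≤ 1 := by
  refine ENNReal.toReal_le_of_le_ofReal zero_le_one
    ((measure_mono (Set.Icc_subset_Icc ha hb)).trans ?_)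
  simp [Real.volume_Icc_pi]

theorem perimeter_Icc_le {d : ℕ} {a b : Fin d → ℝ} (ha : a ∈ cube d) (hb : b ∈ cube d)
    (hab : a ≤ b) : perimeter (Set.Icc a b) ≤ ENNReal.ofReal (2 * d) := by
  cases d with
  | zero => simp [perimeter, variation, divergence]
  | succ n =>
    refine iSup₂_le fun v hv => ENNReal.ofReal_le_ofReal ?_
    have hface : ∀ (i : Fin (n + 1)) (g : (Fin n → ℝ) → Fin (n + 1) → ℝ),
        |∫ x in Set.Icc (a ∘ i.succAbove) (b ∘ i.succAbove), v (g x) i| ≤ 1 := fun i g => calc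
      _ ≤ 1 * volume.real (Set.Icc (a ∘ i.succAbove) (b ∘ i.succAbove)) :=
        norm_setIntegral_le_of_norm_le_const isCompact_Icc.measure_lt_top
          fun x _ => (PiLp.norm_apply_le (v (g x)) i).trans (hv.norm_le_one _)
      _ ≤ 1 := (one_mul _).trans_le
        (volume_real_Icc_le_one (fun j => ha.1 (i.succAbove j)) fun j => hb.2 (i.succAbove j))
    calc ∫ x, (Set.Icc a b).indicator (fun _ => (1 : ℝ)) x * divergence v x
        = ∫ x in Set.Icc a b, divergence v x := by
          rw [← integral_indicator measurableSet_Icc]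
          simp only [← Set.indicator_mul_left, one_mul]
      _ ≤ ∑ _ : Fin (n + 1), (2 : ℝ) := by
          rw [setIntegral_Icc_divergence hab hv]
          refine Finset.sum_le_sum fun i _ => (le_abs_self _).trans ((abs_sub _ _).trans ?_)
          exact (add_le_add (hface i _) (hface i _)).trans_eq one_add_one_eq_two
      _ = 2 * (n + 1 : ℕ) := by
          rw [Finset.sum_const, Finset.card_univ, Fintype.card_fin, nsmul_eq_mul, mul_comm]

variable {d : ℕ}

/-- The rectangle `∏ [a_i, b_i]` in `[0,1]^d`, as a `BV`-set. -/
def rect (a b : cube d) (hab : a ≤ b) : BVSet d where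
  carrier := Set.Icc (a : Fin d → ℝ) b
  subset_cube := Set.Icc_subset_Icc a.2.1 b.2.2
  nullMeasurable := measurableSet_Icc.nullMeasurableSet
  perimeter_lt_top := perimeter_Icc_lt_top _ _ hab

theorem mem_pi_Ico_gridPt_iff {n : ℕ} {p q k : Fin d → ℕ} (hp : ∀ i, p i ≤ 2 ^ n)
    (hq : ∀ i, q i ≤ 2 ^ n) {x : Fin d → ℝ} (hx : x ∈ cell n k) :
    x ∈ Set.univ.pi (fun i => Set.Ico ((gridPt n p : Fin d → ℝ) i) ((gridPt n q : Fin d → ℝ) i))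
      ↔ k ∈ Fintype.piFinset fun i => Finset.Ico (p i) (q i) := by
  have h2 : (0 : ℝ) < 2 ^ n := by positivity
  rw [Fintype.mem_piFinset, Set.mem_univ_pi]
  refine forall_congr' fun i => ?_
  have hle : (p i : ℝ) ≤ 2 ^ n * x i ↔ (p i : ℤ) ≤ k i := by
    rw [← mem_cell_iff_floor.1 hx i, Int.le_floor, Int.cast_natCast]
  have hlt : 2 ^ n * x i < (q i : ℝ) ↔ (k i : ℤ) < q i := by
    rw [← mem_cell_iff_floor.1 hx i, Int.floor_lt, Int.cast_natCast]
  rw [gridPt_apply hp, gridPt_apply hq, Set.mem_Ico, Finset.mem_Ico, div_le_iff₀' h2,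
    lt_div_iff₀' h2, hle, hlt, Int.ofNat_le, Int.ofNat_lt]

theorem volume_real_Icc_gridPt_inter_cell {n : ℕ} {p q : Fin d → ℕ} (hp : ∀ i, p i ≤ 2 ^ n)
    (hq : ∀ i, q i ≤ 2 ^ n) (k : Fin d → ℕ) :
    volume.real (Set.Icc (gridPt n p : Fin d → ℝ) (gridPt n q) ∩ cell n k)
      = if k ∈ Fintype.piFinset fun i => Finset.Ico (p i) (q i) then (2 ^ (n * d) : ℝ)⁻¹
        else 0 := by
  have hae : Set.univ.pi (fun i =>
      Set.Ico ((gridPt n p : Fin d → ℝ) i) ((gridPt n q : Fin d → ℝ) i))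
        =ᵐ[volume] Set.Icc (gridPt n p : Fin d → ℝ) (gridPt n q) := Measure.univ_pi_Ico_ae_eq_Icc
  rw [← measureReal_congr (hae.inter (ae_eq_refl (cell n k)))]
  split_ifs with hk
  · rw [Set.inter_eq_right.2 fun x hx => (mem_pi_Ico_gridPt_iff hp hq hx).2 hk,
      volume_real_cell]
  · rw [Set.disjoint_iff_inter_eq_empty.1 (Set.disjoint_left.2 fun x hxB hx =>
      hk ((mem_pi_Ico_gridPt_iff hp hq hx).1 hxB)), measureReal_empty]

theorem stepDual_rect_gridPt (f : cube d → ℝ) {n : ℕ} {p q : Fin d → ℕ} (hpq : p ≤ q)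
    (hq : ∀ i, q i ≤ 2 ^ n) :
    stepDual f n (rect _ _ (gridPt_mono n hpq)).ind = increment f (gridPt n p) (gridPt n q) := by
  have hsub : Fintype.piFinset (fun i => Finset.Ico (p i) (q i)) ⊆ grid d n := fun k hk =>
    mem_grid.2 fun i => (Finset.mem_Ico.1 (Fintype.mem_piFinset.1 hk i)).2.trans_le (hq i)
  have hterm : ∀ k, cellDensity f n k * (2 ^ (n * d) : ℝ)⁻¹ = cellIncr f n k := fun k => by
    rw [cellDensity, mul_right_comm, mul_inv_cancel₀ (by positivity), one_mul]
  simp only [stepDual_apply, BVSet.setIntegral_ind _ (measurableSet_cell n _), rect,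
    volume_real_Icc_gridPt_inter_cell (fun i => (hpq i).trans (hq i)) hq, mul_ite, mul_zero,
    hterm]
  rw [← sum_cellIncr_piFinset_Ico f n hpq, ← Finset.sum_filter, Finset.filter_mem_eq_inter,
    Finset.inter_eq_right.2 hsub]

theorem stepDual_add_rect_gridPt (f : cube d → ℝ) {n : ℕ} (m : ℕ) {p q : Fin d → ℕ} (hpq : p ≤ q)
    (hq : ∀ i, q i ≤ 2 ^ n) :
    stepDual f (n + m) (rect _ _ (gridPt_mono n hpq)).ind
      = increment f (gridPt n p) (gridPt n q) := by
  have h := stepDual_rect_gridPt f (n := n + m) (p := fun i => 2 ^ m * p i)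
    (q := fun i => 2 ^ m * q i) (fun i => Nat.mul_le_mul_left _ (hpq i)) fun i => by
      rw [pow_add, mul_comm]
      exact Nat.mul_le_mul_right _ (hq i)
  simpa only [gridPt_add] using h

theorem apply_rect_gridPt_of_tendsto_stepDual {f : cube d → ℝ} {α : StrongDual ℝ (BVCube d)}
    (hα : Filter.Tendsto (stepDual f) Filter.atTop (𝓝 α)) {n : ℕ} {p q : Fin d → ℕ} (hpq : p ≤ q)
    (hq : ∀ i, q i ≤ 2 ^ n) :
    α (rect _ _ (gridPt_mono n hpq)).ind = increment f (gridPt n p) (gridPt n q) := by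
  have hlim := ((ContinuousLinearMap.apply ℝ ℝ
    (rect _ _ (gridPt_mono n hpq)).ind).continuous.tendsto α).comp
      (hα.comp (Filter.tendsto_add_atTop_nat n))
  refine tendsto_nhds_unique hlim (tendsto_const_nhds.congr fun m => ?_)
  rw [Function.comp_apply, Function.comp_apply, ContinuousLinearMap.apply_apply, add_comm m n,
    stepDual_add_rect_gridPt f m hpq hq]

/-- The index of the grid point of generation `n` obtained by rounding `a` down: the largest `k`
with `k_i / 2^n ≤ a_i` for all `i`. -/
def lowerIndex (n : ℕ) (a : cube d) (i : Fin d) : ℕ := ⌊(a : Fin d → ℝ) i * 2 ^ n⌋₊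

theorem lowerIndex_mono (n : ℕ) : Monotone (lowerIndex n : cube d → Fin d → ℕ) :=
  fun _ _ hab i => Nat.floor_mono (mul_le_mul_of_nonneg_right (hab i) (by positivity))

theorem lowerIndex_le (n : ℕ) (a : cube d) (i : Fin d) : lowerIndex n a i ≤ 2 ^ n := by
  refine Nat.floor_le_of_le ?_
  push_cast
  exact mul_le_of_le_one_left (by positivity) (a.2.2 i)

theorem tendsto_gridPt_lowerIndex (a : cube d) :
    Filter.Tendsto (fun n => gridPt n (lowerIndex n a)) Filter.atTop (𝓝 a) := by
  rw [tendsto_subtype_rng, tendsto_pi_nhds]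
  intro i
  simp only [gridPt_apply (lowerIndex_le _ a)]
  exact (tendsto_nat_floor_mul_div_atTop (a.2.1 i)).comp
    (tendsto_pow_atTop_atTop_of_one_lt (one_lt_two (α := ℝ)))

theorem continuous_increment {f : cube d → ℝ} (hf : Continuous f) :
    Continuous fun ab : cube d × cube d => increment f ab.1 ab.2 := by
  refine continuous_finsetSum _ fun s _ => continuous_const.mul (hf.comp ?_)
  refine Continuous.subtype_mk (continuous_pi fun i => ?_) _
  by_cases hi : i ∈ s
  · simp only [Finset.piecewise_eq_of_mem _ _ _ hi]
    exact (continuous_apply i).comp (continuous_subtype_val.comp continuous_fst)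
  · simp only [Finset.piecewise_eq_of_notMem _ _ _ hi]
    exact (continuous_apply i).comp (continuous_subtype_val.comp continuous_snd)

theorem eventually_le_iff_of_tendsto_of_ne {ι β : Type*} [LinearOrder β] [TopologicalSpace β]
    [OrderTopology β] {l : Filter ι} {u : ι → β} {a x : β} (hu : Filter.Tendsto u l (𝓝 a))
    (hx : x ≠ a) : ∀ᶠ i in l, (u i ≤ x ↔ a ≤ x) := by
  rcases hx.lt_or_gt with h | h
  · filter_upwards [hu.eventually_const_lt h] with i hi
    exact iff_of_false hi.not_ge h.not_ge
  · filter_upwards [hu.eventually_lt_const h] with i hi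
    exact iff_of_true hi.le h.le

theorem ae_eventually_mem_Icc_iff {ι κ : Type*} [Fintype κ] {l : Filter ι}
    {a b : ι → κ → ℝ} {a' b' : κ → ℝ} (ha : Filter.Tendsto a l (𝓝 a'))
    (hb : Filter.Tendsto b l (𝓝 b')) :
    ∀ᵐ x : κ → ℝ, ∀ᶠ j in l, (x ∈ Set.Icc (a j) (b j) ↔ x ∈ Set.Icc a' b') := by
  have hne : ∀ c : κ → ℝ, ∀ᵐ x : κ → ℝ, ∀ i, x i ≠ c i := fun c =>
    ae_all_iff.2 fun i => Measure.ae_eval_ne (fun _ : κ => (volume : Measure ℝ)) i (c i)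
  filter_upwards [hne a', hne b'] with x hxa hxb
  filter_upwards
    [Filter.eventually_all.2 fun i =>
      eventually_le_iff_of_tendsto_of_ne (tendsto_pi_nhds.1 ha i) (hxa i),
    Filter.eventually_all.2 fun i =>
      eventually_le_iff_of_tendsto_of_ne (β := ℝᵒᵈ) (tendsto_pi_nhds.1 hb i) (hxb i)]
    with j hja hjb
  exact and_congr (forall_congr' hja) (forall_congr' hjb)

theorem tendsto_volume_symmDiff_Icc {ι : Type*} {l : Filter ι} [l.IsCountablyGenerated]
    {a b : ι → cube d} {a' b' : cube d} (ha : Filter.Tendsto a l (𝓝 a'))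
    (hb : Filter.Tendsto b l (𝓝 b')) :
    Filter.Tendsto (fun j => volume (symmDiff (Set.Icc (a j : Fin d → ℝ) (b j)) (Set.Icc a' b')))
      l (𝓝 0) := by
  rw [← measure_empty (μ := (volume : Measure (Fin d → ℝ)))]
  refine tendsto_measure_of_ae_tendsto_indicator l MeasurableSet.empty
    (fun j => measurableSet_Icc.symmDiff measurableSet_Icc) (B := cube d) measurableSet_Icc
    isCompact_Icc.measure_ne_top
    (.of_forall fun j => Set.symmDiff_subset_union.trans (Set.union_subset
      (Set.Icc_subset_Icc (a j).2.1 (b j).2.2) (Set.Icc_subset_Icc a'.2.1 b'.2.2))) ?_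
  filter_upwards [ae_eventually_mem_Icc_iff (tendsto_subtype_rng.1 ha)
    (tendsto_subtype_rng.1 hb)] with x hx
  filter_upwards [hx] with j hj
  simp only [Set.mem_symmDiff, hj, and_not_self, or_self, Set.mem_empty_iff_false]

theorem apply_rect_of_tendsto_stepDual (hd : 1 ≤ d) {f : cube d → ℝ} (hf : Continuous f)
    {α : StrongDual ℝ (BVCube d)} (hα : α ∈ SCH d)
    (hlim : Filter.Tendsto (stepDual f) Filter.atTop (𝓝 α)) {a b : cube d} (hab : a ≤ b) :
    α (rect a b hab).ind = increment f a b := by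
  have hgrid : ∀ n, gridPt n (lowerIndex n a) ≤ gridPt n (lowerIndex n b) := fun n =>
    gridPt_mono n (lowerIndex_mono n hab)
  have ha := tendsto_gridPt_lowerIndex a
  have hb := tendsto_gridPt_lowerIndex b
  have hcharge := (isCharge_of_mem_SCH hd hα).tendsto (fun n => rect _ _ (hgrid n))
    (rect a b hab)
    ((iSup_le fun n => perimeter_Icc_le (Subtype.coe_prop _) (Subtype.coe_prop _)
      (hgrid n)).trans_lt ENNReal.ofReal_lt_top)
    (tendsto_volume_symmDiff_Icc ha hb)
  have hincr := ((continuous_increment hf).tendsto (a, b)).comp (ha.prodMk_nhds hb)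
  exact tendsto_nhds_unique hcharge (hincr.congr fun n =>
    (apply_rect_gridPt_of_tendsto_stepDual hlim (lowerIndex_mono n hab) (lowerIndex_le n b)).symm)

theorem extendsIncrement_of_tendsto_stepDual (hd : 1 ≤ d) {f : cube d → ℝ} (hf : Continuous f)
    {α : StrongDual ℝ (BVCube d)} (hα : α ∈ SCH d)
    (hlim : Filter.Tendsto (stepDual f) Filter.atTop (𝓝 α)) :
    ExtendsIncrement f fun B : BVSet d => α B.ind := by
  intro m a b hab hdisj F hF
  have hab' : ∀ j, a j ≤ b j := fun j i => (hab j i).le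
  beta_reduce
  rw [BVSet.ind_eq_sum (R := fun j => rect (a j) (b j) (hab' j)) hF fun j k => hdisj j k, map_sum]
  exact Finset.sum_congr rfl fun j _ => apply_rect_of_tendsto_stepDual hd hf hα hlim (hab' j)

end Rectangles

section Holder

variable {d : ℕ} {f : cube d → ℝ} {γ γ' : ℝ}

/-- The `γ`-Hölder condition for `f`: its increments over the cells of the dyadic grids satisfy
`|Δ_f(K)| ≤ C |K|^γ`. -/
def HasHolderIncrements (γ : ℝ) (f : cube d → ℝ) : Prop :=
  ∃ C : ℝ, 0 ≤ C ∧ ∀ n, ∀ k ∈ grid d n, |cellIncr f n k| ≤ C * volume.real (cell n k) ^ γ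

theorem HasHolderIncrements.mono (h : γ' ≤ γ) :
    HasHolderIncrements γ f → HasHolderIncrements γ' f
  | ⟨C, hC, hf⟩ => ⟨C, hC, fun n k hk => (hf n k hk).trans <| by
      rw [volume_real_cell]
      gcongr C * ?_
      exact Real.rpow_le_rpow_of_exponent_ge (by positivity)
        (inv_le_one_of_one_le₀ (one_le_pow₀ one_le_two)) h⟩

theorem volume_real_cell_rpow (n : ℕ) (k : Fin d → ℕ) (γ : ℝ) :
    volume.real (cell n k) ^ γ = ((2 : ℝ) ^ (-(d * γ))) ^ n := by
  rw [volume_real_cell, Real.inv_rpow (by positivity), ← Real.rpow_natCast, ← Real.rpow_natCast,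
    ← Real.rpow_mul zero_le_two, ← Real.rpow_mul zero_le_two, ← Real.rpow_neg zero_le_two]
  congr 1
  push_cast
  ring

theorem HasHolderIncrements.exists_isStrongCharge (hd : 1 ≤ d) (hγ : ((d : ℝ) - 1) / d < γ)
    (hc : Continuous f) (hf : HasHolderIncrements γ f) :
    ∃ μ : BVSet d → ℝ, IsStrongCharge μ ∧ ExtendsIncrement f μ := by
  obtain ⟨C, hC, hf⟩ := hf
  have hρ : (2 : ℝ) ^ (d - d * γ) < 2 := by
    have : (d : ℝ) - 1 < γ * d := (div_lt_iff₀ (by exact_mod_cast hd)).1 hγ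
    calc (2 : ℝ) ^ (d - d * γ) < 2 ^ (1 : ℝ) :=
          Real.rpow_lt_rpow_of_exponent_lt one_lt_two (by linarith)
      _ = 2 := Real.rpow_one 2
  have hdensity : ∀ n, ∀ k ∈ grid d n,
      |cellDensity f n k| ≤ C * ((2 : ℝ) ^ (d - d * γ)) ^ n := fun n k hk => by
    calc |cellDensity f n k| = 2 ^ (n * d) * |cellIncr f n k| := by
          rw [cellDensity, abs_mul, abs_of_pos (by positivity)]
      _ ≤ 2 ^ (n * d) * (C * volume.real (cell n k) ^ γ) := by gcongr; exact hf n k hk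
      _ = C * ((2 : ℝ) ^ (d - d * γ)) ^ n := by
          rw [volume_real_cell_rpow, sub_eq_add_neg, Real.rpow_add two_pos, Real.rpow_natCast,
            mul_pow, ← pow_mul, mul_comm d n]
          ring
  obtain ⟨α, hα, hlim⟩ := exists_tendsto_stepDual hC (by positivity) hρ hdensity
  exact ⟨_, isStrongCharge_of_mem_SCH hd hα, extendsIncrement_of_tendsto_stepDual hd hc hα hlim⟩

theorem Icc_gridPt_eq {n : ℕ} {k : Fin d → ℕ} (hk : k ∈ grid d n) :
    Set.Icc (gridPt n k : Fin d → ℝ) (gridPt n (k + 1))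
      = Set.Icc (fun i => (k i : ℝ) / 2 ^ n) (fun i => ((k i : ℝ) + 1) / 2 ^ n) := by
  congr 1 <;> ext i
  · exact gridPt_apply (fun i => (mem_grid.1 hk i).le) i
  · rw [gridPt_apply (k := k + 1) fun i => mem_grid.1 hk i]
    push_cast [Pi.add_apply, Pi.one_apply]
    rfl

theorem ExtendsIncrement.apply_rect {μ : BVSet d → ℝ} (hμ : ExtendsIncrement f μ) {a b : cube d}
    (hab : ∀ i, (a : Fin d → ℝ) i < (b : Fin d → ℝ) i) {K : BVSet d}
    (hK : K.carrier = Set.Icc (a : Fin d → ℝ) b) : μ K = increment f a b := by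
  have := hμ 1 (fun _ => a) (fun _ => b) (fun _ => hab)
    (fun j l hjl => absurd (Subsingleton.elim j l) hjl) K (by rw [hK, Set.iUnion_const])
  rwa [Fin.sum_univ_one] at this

theorem HasHolderIncrements.isHolderOnDyadic (hf : HasHolderIncrements γ f) {μ : BVSet d → ℝ}
    (hμ : ExtendsIncrement f μ) : IsHolderOnDyadic γ μ := by
  obtain ⟨C, hC, hf⟩ := hf
  refine ⟨C, hC, ?_⟩
  rintro K ⟨n, k, hk, hK⟩
  have hkg : k ∈ grid d n := mem_grid.2 hk
  have hlt : ∀ i, (gridPt n k : Fin d → ℝ) i < (gridPt n (k + 1) : Fin d → ℝ) i := fun i => by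
    rw [gridPt_apply (fun i => (hk i).le), gridPt_apply (k := k + 1) fun i => hk i]
    gcongr
    exact Nat.lt_succ_self (k i)
  have hvol : (volume K.carrier).toReal = volume.real (cell n k) := by
    rw [hK]
    exact congrArg _ (measure_congr Measure.univ_pi_Ico_ae_eq_Icc).symm
  rw [hμ.apply_rect hlt (hK.trans (Icc_gridPt_eq hkg).symm), hvol]
  exact hf n k hkg

end Holder

section GaussianBounds

variable {Ω : Type*} [MeasurableSpace Ω] {P : Measure Ω}

theorem ae_iSup_lt_top_of_tsum_lintegral_pow_ne_top {ι : Type*} [Countable ι] {Y : ι → Ω → ℝ≥0∞}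
    {p : ℕ} (hp : p ≠ 0) (hY : ∀ i, AEMeasurable (Y i) P)
    (hsum : ∑' i, ∫⁻ ω, Y i ω ^ p ∂P ≠ ∞) : ∀ᵐ ω ∂P, ⨆ i, Y i ω < ∞ := by
  have hYp : ∀ i, AEMeasurable (fun ω => Y i ω ^ p) P := fun i => (hY i).pow_const p
  rw [← lintegral_tsum hYp] at hsum
  filter_upwards [ae_lt_top' (AEMeasurable.tsum hYp) hsum] with ω hω
  refine lt_of_le_of_lt (iSup_le fun i => ?_) (max_lt ENNReal.one_lt_top hω)
  rcases le_total (Y i ω) 1 with h | h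
  · exact h.trans (le_max_left _ _)
  · exact (le_self_pow₀ h hp).trans ((ENNReal.le_tsum i).trans (le_max_right _ _))

theorem lintegral_enorm_pow_of_hasGaussianLaw {X : Ω → ℝ} (hX : HasGaussianLaw X P)
    (h0 : ∫ ω, X ω ∂P = 0) (p : ℕ) :
    ∫⁻ ω, ‖X ω‖ₑ ^ p ∂P
      = ‖√(∫ ω, X ω ^ 2 ∂P)‖ₑ ^ p * ∫⁻ x, ‖x‖ₑ ^ p ∂(gaussianReal 0 1) := by
  have hvar : Var[X; P] = √(∫ ω, X ω ^ 2 ∂P) ^ 2 := by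
    rw [variance_of_integral_eq_zero hX.aemeasurable h0,
      Real.sq_sqrt (integral_nonneg fun ω => sq_nonneg (X ω))]
  have hmap : P.map X = (gaussianReal 0 1).map (√(∫ ω, X ω ^ 2 ∂P) * ·) := by
    rw [hX.map_eq_gaussianReal, h0, gaussianReal_map_const_mul, hvar, mul_zero, mul_one]
    congr 1
    exact Real.toNNReal_of_nonneg (sq_nonneg _)
  have hm : Measurable fun x : ℝ => ‖x‖ₑ ^ p := by fun_prop
  rw [← lintegral_map' (f := fun x : ℝ => ‖x‖ₑ ^ p) hm.aemeasurable hX.aemeasurable, hmap,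
    lintegral_map hm (by fun_prop), ← lintegral_const_mul _ hm]
  simp only [enorm_mul, mul_pow]

theorem lintegral_enorm_pow_gaussianReal_lt_top (p : ℕ) :
    ∫⁻ x, ‖x‖ₑ ^ p ∂(gaussianReal 0 1) < ∞ := by
  rcases eq_or_ne p 0 with rfl | hp
  · simp
  · simpa using lintegral_rpow_enorm_lt_top_of_eLpNorm_lt_top (by simpa using hp) (by simp)
      (memLp_id_gaussianReal (μ := 0) (v := 1) p).2

theorem exists_natCast_mul_enorm_pow_lt_one (N : ℕ) {s : ℝ} (hs : 0 ≤ s) (hs1 : s < 1) :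
    ∃ p : ℕ, p ≠ 0 ∧ (N : ℝ≥0∞) * ‖s‖ₑ ^ p < 1 := by
  obtain ⟨p, hp⟩ := exists_pow_lt_of_lt_one (by positivity : (0 : ℝ) < ((N : ℝ) + 1)⁻¹) hs1
  refine ⟨p, ?_, ?_⟩
  · rintro rfl
    rw [pow_zero] at hp
    exact absurd hp (not_lt.2 (inv_le_one_of_one_le₀ (by linarith [N.cast_nonneg (α := ℝ)])))
  · have h : (N : ℝ) * s ^ p < 1 := by
      have := (lt_inv_mul_iff₀ (by positivity : (0 : ℝ) < N + 1)).1 (by rwa [mul_one])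
      nlinarith [pow_nonneg hs p]
    rwa [← enorm_pow, Real.enorm_of_nonneg (by positivity), ← ENNReal.ofReal_natCast,
      ← ENNReal.ofReal_mul (by positivity), ENNReal.ofReal_lt_one]

theorem ae_exists_forall_abs_le_of_lintegral_enorm_pow_le {κ : Type*} {S : ℕ → Finset κ} {N : ℕ}
    (hS : ∀ n, (S n).card ≤ N ^ n) {Y : ℕ → κ → Ω → ℝ}
    (hY : ∀ n, ∀ k ∈ S n, AEMeasurable (Y n k) P) {p : ℕ} (hp : p ≠ 0) {K r : ℝ≥0∞}
    (hK : K ≠ ∞) (hr : N * r < 1)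
    (hmoment : ∀ n, ∀ k ∈ S n, ∫⁻ ω, ‖Y n k ω‖ₑ ^ p ∂P ≤ K * r ^ n) :
    ∀ᵐ ω ∂P, ∃ C : ℝ, 0 ≤ C ∧ ∀ n, ∀ k ∈ S n, |Y n k ω| ≤ C := by
  have hlevel : ∀ n, ∑ k ∈ S n, ∫⁻ ω, ‖Y n k ω‖ₑ ^ p ∂P ≤ K * (N * r) ^ n := fun n => by
    calc ∑ k ∈ S n, ∫⁻ ω, ‖Y n k ω‖ₑ ^ p ∂P ≤ (S n).card • (K * r ^ n) :=
          Finset.sum_le_card_nsmul _ _ _ (hmoment n)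
      _ ≤ (N : ℝ≥0∞) ^ n * (K * r ^ n) := by
          rw [nsmul_eq_mul]
          gcongr
          exact_mod_cast hS n
      _ = K * (N * r) ^ n := by ring
  have hsum : ∑' i : Σ n, S n, ∫⁻ ω, ‖Y i.1 i.2 ω‖ₑ ^ p ∂P ≠ ∞ := by
    have hgeom : ∑' n, K * (N * r) ^ n ≠ ∞ := by
      rw [ENNReal.tsum_mul_left, ENNReal.tsum_geometric]
      exact ENNReal.mul_ne_top hK (ENNReal.inv_ne_top.2 (tsub_pos_of_lt hr).ne')
    refine ne_top_of_le_ne_top hgeom ?_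
    rw [ENNReal.tsum_sigma']
    refine ENNReal.tsum_le_tsum fun n => ?_
    rw [Finset.tsum_subtype (S n) fun k => ∫⁻ ω, ‖Y n k ω‖ₑ ^ p ∂P]
    exact hlevel n
  filter_upwards [ae_iSup_lt_top_of_tsum_lintegral_pow_ne_top (ι := Σ n, S n)
    (Y := fun i ω => ‖Y i.1 i.2 ω‖ₑ) hp (fun i => (hY i.1 i.2 i.2.2).enorm) hsum] with ω hω
  refine ⟨(⨆ i : Σ n, S n, ‖Y i.1 i.2 ω‖ₑ).toReal, ENNReal.toReal_nonneg, fun n k hk => ?_⟩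
  have := ENNReal.toReal_mono hω.ne (le_iSup (fun i : Σ n, S n => ‖Y i.1 i.2 ω‖ₑ) ⟨n, k, hk⟩)
  rwa [toReal_enorm, Real.norm_eq_abs] at this

theorem ae_exists_forall_abs_le_of_hasGaussianLaw {κ : Type*} {S : ℕ → Finset κ} {N : ℕ}
    (hS : ∀ n, (S n).card ≤ N ^ n) {Y : ℕ → κ → Ω → ℝ}
    (hY : ∀ n, ∀ k ∈ S n, HasGaussianLaw (Y n k) P)
    (h0 : ∀ n, ∀ k ∈ S n, ∫ ω, Y n k ω ∂P = 0) {A q : ℝ} (hq : 0 ≤ q) (hq1 : q < 1)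
    (hvar : ∀ n, ∀ k ∈ S n, ∫ ω, Y n k ω ^ 2 ∂P ≤ A * q ^ n) :
    ∀ᵐ ω ∂P, ∃ C : ℝ, 0 ≤ C ∧ ∀ n, ∀ k ∈ S n, |Y n k ω| ≤ C := by
  obtain ⟨p, hp, hr⟩ := exists_natCast_mul_enorm_pow_lt_one N (Real.sqrt_nonneg q)
    ((Real.sqrt_lt' one_pos).2 (by rwa [one_pow]))
  have hM := (lintegral_enorm_pow_gaussianReal_lt_top p).ne
  set M := ∫⁻ x, ‖x‖ₑ ^ p ∂(gaussianReal 0 1)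
  refine ae_exists_forall_abs_le_of_lintegral_enorm_pow_le hS
    (fun n k hk => (hY n k hk).aemeasurable) hp (K := ‖√A‖ₑ ^ p * M)
    (ENNReal.mul_ne_top (by finiteness) hM) hr fun n k hk => ?_
  have hσ : √(∫ ω, Y n k ω ^ 2 ∂P) ≤ √A * √q ^ n := by
    have : √(A * q ^ n) = √A * √q ^ n := by
      rw [Real.sqrt_mul' A (pow_nonneg hq n), ← Real.sq_sqrt hq, ← pow_mul, mul_comm 2, pow_mul,
        Real.sqrt_sq (by positivity), Real.sq_sqrt hq]
    exact this ▸ Real.sqrt_le_sqrt (hvar n k hk)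
  calc ∫⁻ ω, ‖Y n k ω‖ₑ ^ p ∂P = ‖√(∫ ω, Y n k ω ^ 2 ∂P)‖ₑ ^ p * M :=
        lintegral_enorm_pow_of_hasGaussianLaw (hY n k hk) (h0 n k hk) p
    _ ≤ ‖√A * √q ^ n‖ₑ ^ p * M := by
        gcongr ?_ ^ p * M
        rw [Real.enorm_of_nonneg (by positivity), Real.enorm_of_nonneg (by positivity)]
        exact ENNReal.ofReal_le_ofReal hσ
    _ = ‖√A‖ₑ ^ p * M * (‖√q‖ₑ ^ p) ^ n := by
        rw [enorm_mul, enorm_pow]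
        ring

end GaussianBounds

section Processes

variable {d : ℕ} {Ω : Type*} [MeasurableSpace Ω] {P : Measure Ω} {X : cube d → Ω → ℝ}

theorem integral_increment (hX : ∀ t, Integrable (X t) P) (a b : cube d) :
    ∫ ω, increment (fun t => X t ω) a b ∂P = increment (fun t => ∫ ω, X t ω ∂P) a b := by
  simp only [increment]
  rw [integral_finsetSum _ fun s _ => (hX (vertex a b s)).const_mul _]
  simp only [integral_const_mul]

theorem increment_mul_const (f : cube d → ℝ) (c : ℝ) (a b : cube d) :
    increment f a b * c = increment (fun t => f t * c) a b := by
  simp only [increment, Finset.sum_mul, mul_assoc]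

theorem integral_increment_sq (hX : ∀ t, MemLp (X t) 2 P) (a b : cube d) :
    ∫ ω, increment (fun t => X t ω) a b ^ 2 ∂P
      = increment (fun t => increment (fun t' => ∫ ω, X t' ω * X t ω ∂P) a b) a b := by
  have hΔ : MemLp (fun ω => increment (fun t => X t ω) a b) 2 P :=
    memLp_finsetSum _ fun s _ => (hX (vertex a b s)).const_mul _
  have hmul : ∀ t, ∫ ω, X t ω * increment (fun t => X t ω) a b ∂P
      = increment (fun t' => ∫ ω, X t' ω * X t ω ∂P) a b := fun t => by
    simp only [mul_comm (X t _), increment_mul_const]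
    exact integral_increment (fun t' => (hX t').integrable_mul (hX t)) a b
  have hsq : ∀ ω, increment (fun t => X t ω) a b ^ 2
      = increment (fun t => X t ω * increment (fun t' => X t' ω) a b) a b := fun ω => by
    rw [sq, increment_mul_const]
  simp only [hsq]
  refine (integral_increment (X := fun t ω => X t ω * increment (fun t' => X t' ω) a b)
    (fun t => (hX t).integrable_mul hΔ) a b).trans ?_
  simp only [hmul]

theorem hasGaussianLaw_increment (hX : IsGaussianProcess X P) (a b : cube d) :
    HasGaussianLaw (fun ω => increment (fun t => X t ω) a b) P :=
  ((hX.comp_right (vertex a b)).smul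
    fun s : Finset (Fin d) => (-1) ^ s.card).hasGaussianLaw_fun_sum (I := Finset.univ)

theorem integral_increment_eq_zero (hX : IsGaussianProcess X P) (h0 : ∀ t, ∫ ω, X t ω ∂P = 0)
    (a b : cube d) : ∫ ω, increment (fun t => X t ω) a b ∂P = 0 := by
  rw [integral_increment fun t => (hX.hasGaussianLaw_eval t).integrable]
  simp only [h0, increment, mul_zero, Finset.sum_const_zero]

theorem card_grid (d n : ℕ) : (grid d n).card = (2 ^ d) ^ n := by
  simp only [grid, Fintype.card_piFinset, Finset.card_range, Finset.prod_const, Finset.card_univ,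
    Fintype.card_fin, ← pow_mul, mul_comm]

theorem ae_hasHolderIncrements (hd : 1 ≤ d) (hX : IsGaussianProcess X P)
    (h0 : ∀ t, ∫ ω, X t ω ∂P = 0) {A h γ : ℝ} (hγ : γ < h)
    (hvar : ∀ n, ∀ k ∈ grid d n, ∫ ω, cellIncr (fun t => X t ω) n k ^ 2 ∂P
      ≤ A * volume.real (cell n k) ^ (2 * h)) :
    ∀ᵐ ω ∂P, HasHolderIncrements γ fun t => X t ω := by
  have hd0 : (0 : ℝ) < d := by exact_mod_cast hd
  have hvol : ∀ n (k : Fin d → ℕ), 0 < volume.real (cell n k) := fun n k => by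
    rw [volume_real_cell]
    positivity
  have hbound : ∀ᵐ ω ∂P, ∃ C : ℝ, 0 ≤ C ∧ ∀ n, ∀ k ∈ grid d n,
      |volume.real (cell n k) ^ (-γ) * cellIncr (fun t => X t ω) n k| ≤ C := by
    refine ae_exists_forall_abs_le_of_hasGaussianLaw (N := 2 ^ d) (A := A)
      (q := (2 : ℝ) ^ (-(d * (2 * (h - γ))))) (fun n => (card_grid d n).le)
      (fun n k _ => (hasGaussianLaw_increment hX _ _).fun_smul _) (fun n k _ => ?_)
      (by positivity) (Real.rpow_lt_one_of_one_lt_of_neg one_lt_two ?_) fun n k hk => ?_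
    · rw [integral_const_mul]
      exact mul_eq_zero_of_right _ (integral_increment_eq_zero hX h0 _ _)
    · nlinarith
    · calc ∫ ω, (volume.real (cell n k) ^ (-γ) * cellIncr (fun t => X t ω) n k) ^ 2 ∂P
          = volume.real (cell n k) ^ (-γ * (2 : ℕ))
              * ∫ ω, cellIncr (fun t => X t ω) n k ^ 2 ∂P := by
            simp only [mul_pow]
            rw [integral_const_mul, Real.rpow_mul_natCast (hvol n k).le]
        _ ≤ volume.real (cell n k) ^ (-γ * (2 : ℕ))
              * (A * volume.real (cell n k) ^ (2 * h)) := by gcongr; exact hvar n k hk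
        _ = A * volume.real (cell n k) ^ (2 * (h - γ)) := by
            rw [mul_left_comm, ← Real.rpow_add (hvol n k)]
            congr 2
            push_cast
            ring
        _ = _ := by rw [volume_real_cell_rpow]
  filter_upwards [hbound] with ω ⟨C, hC, hω⟩
  refine ⟨C, hC, fun n k hk => ?_⟩
  have := hω n k hk
  rwa [abs_mul, abs_of_pos (Real.rpow_pos_of_pos (hvol n k) _), Real.rpow_neg (hvol n k).le,
    inv_mul_le_iff₀ (Real.rpow_pos_of_pos (hvol n k) _), mul_comm] at this

theorem ae_forall_lt_hasHolderIncrements (hd : 1 ≤ d) (hX : IsGaussianProcess X P)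
    (h0 : ∀ t, ∫ ω, X t ω ∂P = 0) {A h : ℝ}
    (hvar : ∀ n, ∀ k ∈ grid d n, ∫ ω, cellIncr (fun t => X t ω) n k ^ 2 ∂P
      ≤ A * volume.real (cell n k) ^ (2 * h)) :
    ∀ᵐ ω ∂P, ∀ γ < h, HasHolderIncrements γ fun t => X t ω := by
  have hseq : ∀ᵐ ω ∂P, ∀ m : ℕ, HasHolderIncrements (h - 1 / ((m : ℝ) + 1)) fun t => X t ω :=
    ae_all_iff.2 fun m => ae_hasHolderIncrements hd hX h0 (sub_lt_self _ (by positivity)) hvar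
  filter_upwards [hseq] with ω hω γ hγ
  obtain ⟨m, hm⟩ := exists_nat_one_div_lt (sub_pos.2 hγ)
  exact (hω m).mono (by linarith)

theorem ae_isC0 (hcont : ∀ᵐ ω ∂P, Continuous fun t => X t ω)
    (hzero : ∀ (t : cube d) (i : Fin d), (t : Fin d → ℝ) i = 0 → ∀ᵐ ω ∂P, X t ω = 0) :
    ∀ᵐ ω ∂P, IsC0 fun t => X t ω := by
  have hface : ∀ i, ∀ᵐ ω ∂P, (Continuous fun t => X t ω) →
      ∀ t : cube d, (t : Fin d → ℝ) i = 0 → X t ω = 0 := by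
    intro i
    obtain ⟨D, hDc, hD⟩ := TopologicalSpace.exists_countable_dense
      {t : cube d // (t : Fin d → ℝ) i = 0}
    filter_upwards [(ae_ball_iff hDc).2 fun t _ => hzero t i t.2] with ω hω hc t ht
    exact congrFun (Continuous.ext_on hD (hc.comp continuous_subtype_val) continuous_const
      hω) ⟨t, ht⟩
  filter_upwards [ae_all_iff.2 hface, hcont] with ω hω hc
  exact ⟨hc, fun t ⟨i, hi⟩ => hω i hc t hi⟩

end Processes

section FractionalBrownianSheet

theorem phi_self {h : ℝ} (hh : h ≠ 0) (t : ℝ) : phi h t t = |t| ^ (2 * h) := by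
  rw [phi, sub_self, abs_zero, Real.zero_rpow (mul_ne_zero two_ne_zero hh)]
  ring

theorem phi_increment {h : ℝ} (hh : h ≠ 0) (a b : ℝ) :
    (phi h b b - phi h a b) - (phi h b a - phi h a a) = |b - a| ^ (2 * h) := by
  rw [phi_self hh, phi_self hh, phi, phi, abs_sub_comm a b]
  ring

namespace IsFractionalBrownianSheet

variable {d : ℕ} {Ω : Type*} [MeasurableSpace Ω] {P : Measure Ω} {H : Fin d → ℝ}
  {W : cube d → Ω → ℝ}

theorem memLp_two (hW : IsFractionalBrownianSheet H W P) (t : cube d) : MemLp (W t) 2 P :=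
  (hW.gaussian.hasGaussianLaw_eval t).memLp_two

theorem integral_increment_sq (hW : IsFractionalBrownianSheet H W P) (hH : ∀ i, H i ≠ 0)
    (a b : cube d) :
    ∫ ω, increment (fun t => W t ω) a b ^ 2 ∂P
      = ∏ i, |(b : Fin d → ℝ) i - (a : Fin d → ℝ) i| ^ (2 * H i) := by
  have hprod : ∀ G : Fin d → ℝ → ℝ, increment (fun t => ∏ i, G i ((t : Fin d → ℝ) i)) a b
      = ∏ i, (G i ((b : Fin d → ℝ) i) - G i ((a : Fin d → ℝ) i)) :=
    fun G => boxIncrement_prod G (a : Fin d → ℝ) b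
  have hinner : ∀ t : cube d, increment (fun t' => ∫ ω, W t' ω * W t ω ∂P) a b
      = ∏ i, (phi (H i) ((b : Fin d → ℝ) i) ((t : Fin d → ℝ) i)
        - phi (H i) ((a : Fin d → ℝ) i) ((t : Fin d → ℝ) i)) := fun t => by
    simp only [hW.covariance]
    exact hprod fun i x => phi (H i) x ((t : Fin d → ℝ) i)
  rw [FBS.integral_increment_sq hW.memLp_two]
  simp only [hinner]
  rw [hprod fun i x => phi (H i) ((b : Fin d → ℝ) i) x - phi (H i) ((a : Fin d → ℝ) i) x]
  exact Finset.prod_congr rfl fun i _ => phi_increment (hH i) _ _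

theorem integral_cellIncr_sq (hW : IsFractionalBrownianSheet H W P) (hH : ∀ i, H i ≠ 0) {n : ℕ}
    {k : Fin d → ℕ} (hk : k ∈ grid d n) :
    ∫ ω, cellIncr (fun t => W t ω) n k ^ 2 ∂P
      = volume.real (cell n k) ^ (2 * ((∑ i, H i) / d)) := by
  have hside : ∀ i, |(gridPt n (k + 1) : Fin d → ℝ) i - (gridPt n k : Fin d → ℝ) i|
      = (2 ^ n : ℝ)⁻¹ := fun i => by
    rw [gridPt_apply fun i => (mem_grid.1 hk i).le,
      gridPt_apply (k := k + 1) fun i => mem_grid.1 hk i, ← sub_div]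
    push_cast [Pi.add_apply, Pi.one_apply]
    rw [add_sub_cancel_left, one_div, abs_of_pos (by positivity)]
  have hexp : ∑ i, 2 * H i = d * (2 * ((∑ i, H i) / d)) := by
    rcases eq_or_ne d 0 with rfl | hd
    · simp
    · rw [← Finset.mul_sum]
      field_simp
  simp only [cellIncr]
  rw [hW.integral_increment_sq hH]
  simp only [hside]
  rw [← Real.rpow_sum_of_pos (by positivity), hexp, Real.rpow_mul (by positivity),
    Real.rpow_natCast, volume_real_cell, inv_pow, pow_mul]

theorem ae_eq_zero (hW : IsFractionalBrownianSheet H W P) (hH : ∀ i, H i ≠ 0) (t : cube d)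
    (i : Fin d) (hi : (t : Fin d → ℝ) i = 0) : ∀ᵐ ω ∂P, W t ω = 0 := by
  have hsq : ∫ ω, W t ω ^ 2 ∂P = 0 := by
    simp only [sq, hW.covariance]
    refine Finset.prod_eq_zero (Finset.mem_univ i) ?_
    rw [hi, phi_self (hH i), abs_zero, Real.zero_rpow (mul_ne_zero two_ne_zero (hH i))]
  filter_upwards [(integral_eq_zero_iff_of_nonneg (fun ω => sq_nonneg (W t ω))
    (hW.memLp_two t).integrable_sq).1 hsq] with ω hω
  exact sq_eq_zero_iff.1 hω

end IsFractionalBrownianSheet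

end FractionalBrownianSheet

end FBS

end

theorem mainTheorem1_general {d : ℕ} (hd : 1 ≤ d) {Ω : Type*} [MeasurableSpace Ω] {P : Measure Ω}
    {X : FBS.cube d → Ω → ℝ} (hX : IsGaussianProcess X P) (h0 : ∀ t, ∫ ω, X t ω ∂P = 0)
    (hcont : ∀ᵐ ω ∂P, Continuous fun t => X t ω)
    (hzero : ∀ (t : FBS.cube d) (i : Fin d), (t : Fin d → ℝ) i = 0 → ∀ᵐ ω ∂P, X t ω = 0)
    {A h : ℝ} (hh : ((d : ℝ) - 1) / d < h)
    (hvar : ∀ n, ∀ k ∈ FBS.grid d n, ∫ ω, FBS.cellIncr (fun t => X t ω) n k ^ 2 ∂P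
      ≤ A * volume.real (FBS.cell n k) ^ (2 * h)) :
    ∀ᵐ ω ∂P, FBS.IsC0 (fun t => X t ω) ∧
      ∃ μ : FBS.BVSet d → ℝ, FBS.IsStrongCharge μ ∧
        FBS.ExtendsIncrement (fun t => X t ω) μ ∧
        ∀ γ : ℝ, γ < h → FBS.IsHolderOnDyadic γ μ := by
  filter_upwards [FBS.ae_isC0 hcont hzero, FBS.ae_forall_lt_hasHolderIncrements hd hX h0 hvar]
    with ω hC0 hHolder
  obtain ⟨γ₀, hγ₀, hγ₀h⟩ := exists_between hh
  obtain ⟨μ, hμ, hext⟩ := (hHolder γ₀ hγ₀h).exists_isStrongCharge hd hγ₀ hC0.1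
  exact ⟨hC0, μ, hμ, hext, fun γ hγ => (hHolder γ hγ).isHolderOnDyadic hext⟩

theorem mainTheorem1 {d : ℕ} (hd : 1 ≤ d) {Ω : Type*} [MeasurableSpace Ω]
    (P : Measure Ω) [IsProbabilityMeasure P] (H : Fin d → ℝ)
    (hH : ∀ i, H i ∈ Set.Ioo (0 : ℝ) 1) (W : FBS.cube d → Ω → ℝ)
    (hW : FBS.IsFractionalBrownianSheet H W P)
    (hcont : ∀ᵐ ω ∂P, Continuous fun t => W t ω)
    (hmean : ((d : ℝ) - 1) / d < (∑ i, H i) / d) :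
    ∀ᵐ ω ∂P, FBS.IsC0 (fun t => W t ω) ∧
      ∃ μ : FBS.BVSet d → ℝ, FBS.IsStrongCharge μ ∧
        FBS.ExtendsIncrement (fun t => W t ω) μ ∧
        ∀ γ : ℝ, 0 < γ → γ < (∑ i, H i) / d → FBS.IsHolderOnDyadic γ μ := by
  have hH0 : ∀ i, H i ≠ 0 := fun i => (hH i).1.ne'
  exact (mainTheorem1_general hd hW.gaussian hW.centered hcont (hW.ae_eq_zero hH0) hmean
    fun n k hk => ((hW.integral_cellIncr_sq hH0 hk).trans (one_mul _).symm).le).mono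
    fun ω ⟨hC0, μ, hμ, hext, hHolder⟩ => ⟨hC0, μ, hμ, hext, fun γ _ => hHolder γ⟩
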